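/- Let $k$ be a field and let $\Gamma$ and $\Lambda$ be basic finite-dimensional $k$-algebras all of whose simple modules are one-dimensional over $k$. **Generalized arrow removal.** Let $Q$ be a finite quiver and $I$ an admissible ideal of the path algebra $kQ$ (every path occurring in an element of $I$ has length at least $2$, and for some $N\ge 2$ all paths of length $N$ lie in $I$). For a set $A$ of arrows of $Q$ (possibly empty), let $\langle A+I\rangle$ be the two-sided ideal of $kQ/I$ generated by the classes of the arrows in $A$. Write $z=z_A+z_{\neg A}$ for the decomposition of $z\in kQ$ into a combination of paths passing through some arrow in $A$ and a combination of paths avoiding all arrows in $A$. The set $A$ is *pre-removable* if $z_A,z_{\neg A}\in I$ for all $z\in I$. A pre-removable set $A$ is *removable* if either - $\langle A+I\rangle$ has finite projective dimension both as a right and as a left $kQ/I$-module, or - $\langle A+I\rangle^2=0$ and $\langle A+I\rangle$ has finite projective dimension as a right but not as a left $kQ/I$-module. We say that $\Gamma$ is a *generalized arrow removal* of $\Lambda$ if there are such $Q$, $I$ and a removable set $A$ with $\Lambda\cong kQ/I$ and $\Gamma\cong (kQ/I)/\langle A+I\rangle$ as $k$-algebras; it is *proper* if $A$ can moreover be chosen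 non-empty. **Removable multiplicative bimodules.** A *multiplicative $\Gamma$-bimodule* is a pair $(M,\theta)$ where $M$ is a finite-dimensional $\Gamma$-bimodule on which $k$ acts centrally ($M=0$ is allowed) and $\theta\colon M\otimes_\Gamma M\to M$ is a $\Gamma$-bimodule homomorphism with $\theta(\theta\otimes 1)=\theta(1\otimes\theta)$. The *split extension* $E=\Gamma\ltimes_\theta M$ is the $k$-algebra with underlying space $\Gamma\oplus M$ and multiplication $(\gamma_1,m_1)(\gamma_2,m_2)=(\gamma_1\gamma_2,\ \gamma_1m_2+m_1\gamma_2+\theta(m_1\otimes m_2))$; put $\widetilde M=0\oplus M$, an ideal of $E$. The pair $(M,\theta)$ is *nilpotent* if $\theta^N=0$ for some $N\ge1$, where $\theta^0=\mathrm{id}_M$ and $\theta^r=\theta\circ(\theta^{r-1}\otimes 1_M)\colon M^{\otimes_\Gamma(r+1)}\to M$. It is *removable* if it is nilpotent and either - $\widetilde M$ has finite projective dimension both as a right and as a left $E$-module, or - $\theta=0$ and $\widetilde M$ has finite projective dimension as a right but not as a left $E$-module. **Theorem.** (1) $\Gamma$ is a generalized arrow removal of $\Lambda$ if and only if $\Lambda\cong\Gamma\ltimes_\theta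 M$ as $k$-algebras for some removable multiplicative $\Gamma$-bimodule $(M,\theta)$. (2) $\Gamma$ is a proper generalized arrow removal of $\Lambda$ if and only if $\Lambda\cong\Gamma\ltimes_\theta M$ as $k$-algebras for some removable multiplicative $\Gamma$-bimodule $(M,\theta)$ with $M\neq 0$. -/

import Mathlib

universe u v

noncomputable section

/-! ### Path algebras -/

/-- All paths of a quiver (with arbitrary source and target), including the trivial ones. -/
structure QuiverPath (V : Type*) [Quiver V] where
  src : V
  tgt : V
  path : Quiver.Path src tgt

namespace QuiverPath

variable {V : Type*} [Quiver V]

/-- The trivial path at a vertex. -/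
def trivial (v : V) : QuiverPath V := ⟨v, v, Quiver.Path.nil⟩

/-- The path of length one given by an arrow. -/
def ofArrow {a b : V} (e : a ⟶ b) : QuiverPath V := ⟨a, b, e.toPath⟩

/-- The number of arrows in a path. -/
def length (p : QuiverPath V) : ℕ := p.path.length

/-- Concatenation `p q` (first `p`, then `q`) when the target of `p` is the source of `q`. -/
def comp (p q : QuiverPath V) (h : p.tgt = q.src) : QuiverPath V :=
  ⟨p.src, q.tgt, p.path.comp (q.path.cast h.symm rfl)⟩

/-- A path passes through an arrow of `A` if it is of the form `p₁ α p₂` with `α ∈ A`. -/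
def PassesThrough (A : ∀ a b : V, Set (a ⟶ b)) (p : QuiverPath V) : Prop :=
  ∃ (c d : V) (α : c ⟶ d) (p₁ : Quiver.Path p.src c) (p₂ : Quiver.Path d p.tgt),
    α ∈ A c d ∧ p.path = (p₁.comp α.toPath).comp p₂

end QuiverPath

/-- The path algebra `kQ`: the `k`-vector space with basis the set of all paths of `Q`. -/
def PathAlgebra (k : Type*) [Field k] (V : Type*) [Quiver V] : Type _ := QuiverPath V →₀ k

namespace PathAlgebra

variable {k : Type*} [Field k] {V : Type*} [Quiver V]

instance : AddCommGroup (PathAlgebra k V) := inferInstanceAs (AddCommGroup (QuiverPath V →₀ k))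

instance : Module k (PathAlgebra k V) := inferInstanceAs (Module k (QuiverPath V →₀ k))

/-- The identification of `kQ` with the space of finitely supported functions on paths. -/
def toFinsupp : PathAlgebra k V ≃ₗ[k] (QuiverPath V →₀ k) :=
  LinearEquiv.refl k (QuiverPath V →₀ k)

/-- The scalar multiple `c p` of a path `p`. -/
def single (p : QuiverPath V) (c : k) : PathAlgebra k V := toFinsupp.symm (Finsupp.single p c)

/-- The coefficient of the path `p` in `z`. -/
def coeff (z : PathAlgebra k V) (p : QuiverPath V) : k := toFinsupp z p

open Classical in
/-- The product of two paths: their concatenation if it is defined, and zero otherwise. -/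
def pathMul (p q : QuiverPath V) : PathAlgebra k V :=
  if h : p.tgt = q.src then single (p.comp q h) 1 else 0

variable (k V) in
/-- The bilinear extension of the product of paths. -/
def mulHom : PathAlgebra k V →ₗ[k] PathAlgebra k V →ₗ[k] PathAlgebra k V :=
  Finsupp.lift (PathAlgebra k V →ₗ[k] PathAlgebra k V) k (QuiverPath V) (fun p =>
    Finsupp.lift (PathAlgebra k V) k (QuiverPath V) (fun q => pathMul p q) ∘ₗ
      toFinsupp.toLinearMap) ∘ₗ toFinsupp.toLinearMap

instance : Mul (PathAlgebra k V) := ⟨fun x y => mulHom k V x y⟩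

instance [Fintype V] : One (PathAlgebra k V) := ⟨∑ v : V, single (QuiverPath.trivial v) 1⟩

theorem mul_def (x y : PathAlgebra k V) : x * y = mulHom k V x y := rfl

theorem one_def [Fintype V] :
    (1 : PathAlgebra k V) = ∑ v : V, single (QuiverPath.trivial v) 1 := rfl

theorem single_mul_single (p q : QuiverPath V) (c d : k) :
    (single p c * single q d : PathAlgebra k V) = (c * d) • pathMul p q := by
  simp [mul_def, mulHom, single, Finsupp.sum_single_index, smul_smul]

theorem induction_linear {P : PathAlgebra k V → Prop} (z : PathAlgebra k V) (h0 : P 0)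
    (hadd : ∀ x y, P x → P y → P (x + y)) (hs : ∀ p c, P (single p c)) : P z :=
  Finsupp.induction_linear (motive := fun f => P (toFinsupp.symm f)) (toFinsupp z) h0
    (fun _ _ hf hg => hadd _ _ hf hg) hs

theorem smul_single_one (p : QuiverPath V) (c : k) :
    c • (single p 1 : PathAlgebra k V) = single p c := by
  rw [single, single, ← map_smul, Finsupp.smul_single, smul_eq_mul, mul_one]

theorem zero_mul' (x : PathAlgebra k V) : 0 * x = 0 := by simp [mul_def]

theorem mul_zero' (x : PathAlgebra k V) : x * 0 = 0 := by simp [mul_def]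

theorem add_mul' (x y z : PathAlgebra k V) : (x + y) * z = x * z + y * z := by simp [mul_def]

theorem mul_add' (x y z : PathAlgebra k V) : x * (y + z) = x * y + x * z := by simp [mul_def]

theorem smul_mul' (c : k) (x y : PathAlgebra k V) : (c • x) * y = c • (x * y) := by
  simp [mul_def]

theorem mul_smul' (c : k) (x y : PathAlgebra k V) : x * (c • y) = c • (x * y) := by
  simp [mul_def]

theorem pathMul_mul_single (p q r : QuiverPath V) :
    (pathMul p q * single r 1 : PathAlgebra k V) = single p 1 * pathMul q r := by
  obtain ⟨a, b, p⟩ := p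
  obtain ⟨b', c, q⟩ := q
  obtain ⟨c', d, r⟩ := r
  by_cases h : b = b'
  · subst h
    by_cases h' : c = c'
    · subst h'
      simp [pathMul, single_mul_single, QuiverPath.comp]
    · simp [pathMul, single_mul_single, QuiverPath.comp, h', mul_zero']
  · by_cases h' : c = c'
    · subst h'
      simp [pathMul, single_mul_single, QuiverPath.comp, h, zero_mul']
    · simp [pathMul, h, h', mul_zero', zero_mul']

theorem mul_assoc' (x y z : PathAlgebra k V) : x * y * z = x * (y * z) := by
  induction x using induction_linear with
  | h0 => simp only [zero_mul']
  | hadd x x' hx hx' => simp only [add_mul', hx, hx']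
  | hs p a =>
    induction y using induction_linear with
    | h0 => simp only [zero_mul', mul_zero']
    | hadd y y' hy hy' => simp only [add_mul', mul_add', hy, hy']
    | hs q b =>
      induction z using induction_linear with
      | h0 => simp only [mul_zero']
      | hadd z z' hz hz' => simp only [mul_add', hz, hz']
      | hs r c =>
        rw [← smul_single_one p a, ← smul_single_one q b, ← smul_single_one r c]
        simp only [smul_mul', mul_smul']
        rw [single_mul_single, single_mul_single, one_mul, one_smul, one_smul,
          pathMul_mul_single]

theorem one_mul' [Fintype V] (x : PathAlgebra k V) : 1 * x = x := by
  induction x using induction_linear with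
  | h0 => exact mul_zero' _
  | hadd x y hx hy => rw [mul_add', hx, hy]
  | hs p c =>
    rw [one_def, mul_def, map_sum, LinearMap.sum_apply, Finset.sum_eq_single p.src]
    · rw [← mul_def, single_mul_single]
      simp [pathMul, QuiverPath.comp, QuiverPath.trivial, smul_single_one]
    · intro v _ hv
      rw [← mul_def, single_mul_single]
      simp [pathMul, QuiverPath.trivial, hv]
    · simp

theorem mul_one' [Fintype V] (x : PathAlgebra k V) : x * 1 = x := by
  induction x using induction_linear with
  | h0 => exact zero_mul' _
  | hadd x y hx hy => rw [add_mul', hx, hy]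
  | hs p c =>
    rw [one_def, mul_def, map_sum, Finset.sum_eq_single p.tgt]
    · rw [← mul_def, single_mul_single]
      simp [pathMul, QuiverPath.comp, QuiverPath.trivial, smul_single_one]
    · intro v _ hv
      rw [← mul_def, single_mul_single]
      simp [pathMul, QuiverPath.trivial, Ne.symm hv]
    · simp

instance [Fintype V] : Ring (PathAlgebra k V) :=
  { (inferInstance : AddCommGroup (PathAlgebra k V)),
    (inferInstance : Mul (PathAlgebra k V)),
    (inferInstance : One (PathAlgebra k V)) with
    left_distrib := mul_add'
    right_distrib := add_mul'
    zero_mul := zero_mul'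
    mul_zero := mul_zero'
    mul_assoc := mul_assoc'
    one_mul := one_mul'
    mul_one := mul_one' }

instance [Fintype V] : Algebra k (PathAlgebra k V) := Algebra.ofModule smul_mul' mul_smul'

open Classical in
/-- The component `z_A` of `z` in the span of the paths passing through some arrow of `A`. -/
def through (A : ∀ a b : V, Set (a ⟶ b)) (z : PathAlgebra k V) : PathAlgebra k V :=
  toFinsupp.symm (Finsupp.filter (fun p => p.PassesThrough A) (toFinsupp z))

open Classical in
/-- The component of `z` in the span of the paths avoiding all arrows of `A`. -/
def avoiding (A : ∀ a b : V, Set (a ⟶ b)) (z : PathAlgebra k V) : PathAlgebra k V :=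
  toFinsupp.symm (Finsupp.filter (fun p => ¬ p.PassesThrough A) (toFinsupp z))

/-- A two-sided ideal of `kQ` is admissible if every path occurring in it has length at least
two, and for some `N ≥ 2` all paths of length `N` belong to it. -/
def IsAdmissible [Fintype V] (I : TwoSidedIdeal (PathAlgebra k V)) : Prop :=
  (∀ z ∈ I, ∀ p : QuiverPath V, z.coeff p ≠ 0 → 2 ≤ p.length) ∧
    ∃ N : ℕ, 2 ≤ N ∧ ∀ p : QuiverPath V, p.length = N → single p 1 ∈ I

end PathAlgebra

/-! ### Finiteness of projective dimensions of two-sided ideals -/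

/-- The two-sided ideal `K` has finite projective dimension as a left `R`-module. -/
def TwoSidedIdeal.HasFinitePDLeft {R : Type*} [Ring R] (K : TwoSidedIdeal R) : Prop :=
  ∃ n : ℕ, CategoryTheory.HasProjectiveDimensionLE (ModuleCat.of R K) n

/-- The two-sided ideal `K` has finite projective dimension as a right `R`-module. -/
def TwoSidedIdeal.HasFinitePDRight {R : Type*} [Ring R] (K : TwoSidedIdeal R) : Prop :=
  ∃ n : ℕ, CategoryTheory.HasProjectiveDimensionLE (ModuleCat.of Rᵐᵒᵖ K) n

/-! ### Bound quiver algebras and removable sets of arrows -/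

/-- A finite quiver together with an admissible ideal of its path algebra over `k`. -/
structure BoundQuiver (k : Type*) [Field k] where
  V : Type
  [quiver : Quiver.{0} V]
  [fintypeV : Fintype V]
  [finiteHom : ∀ a b : V, Finite (a ⟶ b)]
  I : TwoSidedIdeal (PathAlgebra k V)
  admissible : PathAlgebra.IsAdmissible I

namespace BoundQuiver

variable {k : Type*} [Field k] (Q : BoundQuiver k)

attribute [instance] BoundQuiver.quiver BoundQuiver.fintypeV BoundQuiver.finiteHom

/-- The bound quiver algebra `kQ / I`. -/
abbrev Alg : Type _ := Q.I.ringCon.Quotient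

/-- A set of arrows of the quiver. -/
abbrev ArrowSet : Type _ := ∀ a b : Q.V, Set (a ⟶ b)

variable {Q} (A : Q.ArrowSet)

/-- The two-sided ideal `⟨A + I⟩` of `kQ / I` generated by the classes of the arrows in `A`. -/
def arrowIdeal : TwoSidedIdeal Q.Alg :=
  TwoSidedIdeal.span {x | ∃ (a b : Q.V) (α : a ⟶ b), α ∈ A a b ∧
    x = Q.I.ringCon.mk' (PathAlgebra.single (QuiverPath.ofArrow α) 1)}

/-- `A` is pre-removable if `z_A` and `z_{¬A}` belong to `I` for every `z ∈ I`. -/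
def IsPreRemovable : Prop :=
  ∀ z ∈ Q.I, PathAlgebra.through A z ∈ Q.I ∧ PathAlgebra.avoiding A z ∈ Q.I

/-- `A` is non-repetitive if `⟨A + I⟩² = 0`. -/
def IsNonRepetitive : Prop :=
  ∀ x ∈ arrowIdeal A, ∀ y ∈ arrowIdeal A, x * y = 0

/-- `A` is two-sided removable. -/
def IsTwoSidedRemovable : Prop :=
  IsPreRemovable A ∧ (arrowIdeal A).HasFinitePDRight ∧ (arrowIdeal A).HasFinitePDLeft

/-- `A` is only left removable. -/
def IsOnlyLeftRemovable : Prop :=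
  IsPreRemovable A ∧ IsNonRepetitive A ∧
    (arrowIdeal A).HasFinitePDRight ∧ ¬ (arrowIdeal A).HasFinitePDLeft

/-- `A` is (left) removable. -/
def IsRemovable : Prop := IsTwoSidedRemovable A ∨ IsOnlyLeftRemovable A

/-- `A` contains at least one arrow. -/
def ArrowSetNonempty : Prop := ∃ (a b : Q.V), (A a b).Nonempty

end BoundQuiver

/-- The bound quiver algebra `kQ/I` represents `Λ`, and `Γ` is isomorphic to the quotient of
`kQ/I` by the ideal generated by the removable set of arrows `A`. -/
def IsArrowRemovalVia (k : Type*) [Field k] (Γ Λ : Type*) [Ring Γ] [Algebra k Γ]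
    [Ring Λ] [Algebra k Λ] (Q : BoundQuiver k) (A : Q.ArrowSet) : Prop :=
  BoundQuiver.IsRemovable A ∧ Nonempty (Λ ≃ₐ[k] Q.Alg) ∧
    Nonempty (Γ ≃ₐ[k] (BoundQuiver.arrowIdeal A).ringCon.Quotient)

/-- `Γ` is a generalized arrow removal of `Λ` (the set of arrows may be empty). -/
def IsGeneralizedArrowRemoval (k : Type*) [Field k] (Γ Λ : Type*) [Ring Γ] [Algebra k Γ]
    [Ring Λ] [Algebra k Λ] : Prop :=
  ∃ (Q : BoundQuiver k) (A : Q.ArrowSet), IsArrowRemovalVia k Γ Λ Q A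

/-- `Γ` is a generalized arrow removal of `Λ` by a non-empty set of arrows. -/
def IsProperGeneralizedArrowRemoval (k : Type*) [Field k] (Γ Λ : Type*) [Ring Γ] [Algebra k Γ]
    [Ring Λ] [Algebra k Λ] : Prop :=
  ∃ (Q : BoundQuiver k) (A : Q.ArrowSet),
    BoundQuiver.ArrowSetNonempty A ∧ IsArrowRemovalVia k Γ Λ Q A

/-! ### Multiplicative bimodules and split extensions -/

/-- A multiplication on the `Γ`-bimodule `M`: an associative bimodule homomorphism
`θ : M ⊗_Γ M → M`, given as a biadditive map which is `Γ`-balanced in the middle and `Γ`-linear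
on the left and on the right. -/
structure BimoduleMul (Γ : Type*) [Ring Γ] (M : Type*) [AddCommGroup M] [Module Γ M]
    [Module Γᵐᵒᵖ M] where
  θ : M →+ M →+ M
  balanced : ∀ (m : M) (γ : Γ) (m' : M), θ (MulOpposite.op γ • m) m' = θ m (γ • m')
  smul_left : ∀ (γ : Γ) (m m' : M), θ (γ • m) m' = γ • θ m m'
  smul_right : ∀ (m m' : M) (γ : Γ), θ m (MulOpposite.op γ • m') = MulOpposite.op γ • θ m m'
  assoc : ∀ m₁ m₂ m₃ : M, θ (θ m₁ m₂) m₃ = θ m₁ (θ m₂ m₃)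

/-- The split extension `Γ ⋉_θ M`, with underlying abelian group `Γ ⊕ M`. -/
@[ext]
structure SplitExtension {Γ : Type*} [Ring Γ] {M : Type*} [AddCommGroup M] [Module Γ M]
    [Module Γᵐᵒᵖ M] (μ : BimoduleMul Γ M) where
  fst : Γ
  snd : M

namespace BimoduleMul

variable {Γ : Type*} [Ring Γ] {M : Type*} [AddCommGroup M] [Module Γ M] [Module Γᵐᵒᵖ M]
  (μ : BimoduleMul Γ M)

/-- The iterated multiplication `θ^r (m₀ ⊗ ⋯ ⊗ m_r)`, with `θ^0 = id` and
`θ^r = θ ∘ (θ^(r-1) ⊗ id)`. -/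
def iter : (r : ℕ) → (Fin (r + 1) → M) → M
  | 0, m => m 0
  | r + 1, m => μ.θ (iter r (Fin.init m)) (m (Fin.last (r + 1)))

/-- `(M, θ)` is nilpotent if `θ^N = 0` for some positive `N`. -/
def IsNilpotent : Prop := ∃ N : ℕ, 0 < N ∧ ∀ m : Fin (N + 1) → M, μ.iter N m = 0

end BimoduleMul

namespace SplitExtension

variable {Γ : Type*} [Ring Γ] {M : Type*} [AddCommGroup M] [Module Γ M] [Module Γᵐᵒᵖ M]
  {μ : BimoduleMul Γ M}

/-- The underlying abelian group is `Γ × M`. -/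
def equivProd (μ : BimoduleMul Γ M) : SplitExtension μ ≃ Γ × M where
  toFun x := (x.fst, x.snd)
  invFun x := ⟨x.1, x.2⟩

instance : AddCommGroup (SplitExtension μ) := (equivProd μ).addCommGroup

instance : One (SplitExtension μ) := ⟨⟨1, 0⟩⟩

instance : Mul (SplitExtension μ) :=
  ⟨fun x y => ⟨x.fst * y.fst, x.fst • y.snd + MulOpposite.op y.fst • x.snd + μ.θ x.snd y.snd⟩⟩

@[simp] theorem fst_zero : (0 : SplitExtension μ).fst = 0 := rfl
@[simp] theorem snd_zero : (0 : SplitExtension μ).snd = 0 := rfl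
@[simp] theorem fst_add (x y : SplitExtension μ) : (x + y).fst = x.fst + y.fst := rfl
@[simp] theorem snd_add (x y : SplitExtension μ) : (x + y).snd = x.snd + y.snd := rfl
@[simp] theorem fst_one : (1 : SplitExtension μ).fst = 1 := rfl
@[simp] theorem snd_one : (1 : SplitExtension μ).snd = 0 := rfl
@[simp] theorem fst_mul (x y : SplitExtension μ) : (x * y).fst = x.fst * y.fst := rfl
@[simp] theorem snd_mul (x y : SplitExtension μ) :
    (x * y).snd = x.fst • y.snd + MulOpposite.op y.fst • x.snd + μ.θ x.snd y.snd := rfl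

instance [SMulCommClass Γ Γᵐᵒᵖ M] : Ring (SplitExtension μ) :=
  { (inferInstance : AddCommGroup (SplitExtension μ)),
    (inferInstance : Mul (SplitExtension μ)),
    (inferInstance : One (SplitExtension μ)) with
    left_distrib := fun x y z => by
      ext
      · simp [mul_add]
      · simp [smul_add, add_smul]; abel
    right_distrib := fun x y z => by
      ext
      · simp [add_mul]
      · simp [smul_add, add_smul]; abel
    zero_mul := fun x => by ext <;> simp
    mul_zero := fun x => by ext <;> simp
    mul_assoc := fun x y z => by
      ext
      · simp [mul_assoc]
      · simp [smul_add, mul_smul, μ.smul_left, μ.smul_right, μ.balanced, μ.assoc,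
          smul_comm x.fst (MulOpposite.op z.fst) y.snd]
        abel
    one_mul := fun x => by ext <;> simp
    mul_one := fun x => by ext <;> simp }

section Algebra

variable {k : Type*} [Field k] [Module k M]

section

variable [Algebra k Γ]

instance : Module k (SplitExtension μ) := (equivProd μ).module k

@[simp] theorem fst_smul (c : k) (x : SplitExtension μ) : (c • x).fst = c • x.fst := rfl
@[simp] theorem snd_smul (c : k) (x : SplitExtension μ) : (c • x).snd = c • x.snd := rfl

end

variable [Algebra k Γ] [IsScalarTower k Γ M] [IsScalarTower k Γᵐᵒᵖ M] [SMulCommClass Γ Γᵐᵒᵖ M]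

/-- The canonical `k`-algebra structure, given by `c ↦ (c · 1, 0)`. -/
instance : Algebra k (SplitExtension μ) :=
  Algebra.ofModule
    (fun c x y => by
      have h1 : ∀ (γ : Γ) (m : M), MulOpposite.op γ • c • m = c • MulOpposite.op γ • m := by
        intro γ m
        rw [← smul_one_smul Γ c m, ← smul_one_smul Γ c (MulOpposite.op γ • m),
          smul_comm (c • (1 : Γ)) (MulOpposite.op γ) m]
      have h2 : ∀ m m' : M, μ.θ (c • m) m' = c • μ.θ m m' := by
        intro m m'
        rw [← smul_one_smul Γ c m, μ.smul_left, smul_one_smul]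
      ext
      · simp
      · simp [h1, h2])
    (fun c x y => by
      have h1 : ∀ (γ : Γ) (m : M), γ • c • m = c • γ • m := by
        intro γ m
        rw [← smul_one_smul Γᵐᵒᵖ c m, ← smul_one_smul Γᵐᵒᵖ c (γ • m),
          smul_comm γ (c • (1 : Γᵐᵒᵖ)) m]
      have h2 : ∀ m m' : M, μ.θ m (c • m') = c • μ.θ m m' := by
        intro m m'
        have h3 : (c • (1 : Γᵐᵒᵖ)) = MulOpposite.op (c • (1 : Γ)) := rfl
        rw [← smul_one_smul Γᵐᵒᵖ c m', h3, μ.smul_right, ← h3, smul_one_smul]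
      ext
      · simp
      · simp [h1, h2])

end Algebra

variable [SMulCommClass Γ Γᵐᵒᵖ M]

variable (μ) in
/-- The projection epimorphism `Γ ⋉_θ M → Γ`. -/
def proj : SplitExtension μ →+* Γ where
  toFun x := x.fst
  map_one' := rfl
  map_mul' _ _ := rfl
  map_zero' := rfl
  map_add' _ _ := rfl

variable (μ) in
/-- The ideal `0 ⊕ M` of `Γ ⋉_θ M`. -/
def idealM : TwoSidedIdeal (SplitExtension μ) := TwoSidedIdeal.ker (proj μ)

end SplitExtension

namespace BimoduleMul

variable {Γ : Type*} [Ring Γ] {M : Type*} [AddCommGroup M] [Module Γ M] [Module Γᵐᵒᵖ M]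
  [SMulCommClass Γ Γᵐᵒᵖ M] (μ : BimoduleMul Γ M)

/-- `(M, θ)` is two-sided removable. -/
def IsTwoSidedRemovable : Prop :=
  μ.IsNilpotent ∧ (SplitExtension.idealM μ).HasFinitePDRight ∧
    (SplitExtension.idealM μ).HasFinitePDLeft

/-- `(M, θ)` is only left removable. -/
def IsOnlyLeftRemovable : Prop :=
  μ.IsNilpotent ∧ (SplitExtension.idealM μ).HasFinitePDRight ∧
    ¬ (SplitExtension.idealM μ).HasFinitePDLeft ∧ μ.θ = 0

/-- `(M, θ)` is (left) removable. -/
def IsRemovable : Prop := μ.IsTwoSidedRemovable ∨ μ.IsOnlyLeftRemovable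

end BimoduleMul

/-- `Λ` is isomorphic to a split extension `Γ ⋉_θ M` by a removable multiplicative bimodule,
where `M` is a finite-dimensional bimodule on which `k` acts centrally. Here `M = 0` is allowed. -/
def IsRemovableSplitExtension (k : Type*) [Field k] (Γ : Type*) [Ring Γ] [Algebra k Γ]
    (Λ : Type v) [Ring Λ] [Algebra k Λ] : Prop :=
  ∃ (M : Type v) (_ : AddCommGroup M) (_ : Module k M) (_ : Module Γ M) (_ : Module Γᵐᵒᵖ M)
    (_ : SMulCommClass Γ Γᵐᵒᵖ M) (_ : IsScalarTower k Γ M) (_ : IsScalarTower k Γᵐᵒᵖ M)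
    (_ : Module.Finite k M) (μ : BimoduleMul Γ M),
    μ.IsRemovable ∧ Nonempty (Λ ≃ₐ[k] SplitExtension μ)

/-- `Λ` is isomorphic to a split extension `Γ ⋉_θ M` by a removable multiplicative bimodule
with `M ≠ 0`. -/
def IsProperRemovableSplitExtension (k : Type*) [Field k] (Γ : Type*) [Ring Γ] [Algebra k Γ]
    (Λ : Type v) [Ring Λ] [Algebra k Λ] : Prop :=
  ∃ (M : Type v) (_ : AddCommGroup M) (_ : Module k M) (_ : Module Γ M) (_ : Module Γᵐᵒᵖ M)
    (_ : SMulCommClass Γ Γᵐᵒᵖ M) (_ : IsScalarTower k Γ M) (_ : IsScalarTower k Γᵐᵒᵖ M)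
    (_ : Module.Finite k M) (μ : BimoduleMul Γ M),
    Nontrivial M ∧ μ.IsRemovable ∧ Nonempty (Λ ≃ₐ[k] SplitExtension μ)

/-! ### Basic algebras with one-dimensional simple modules -/

/-- A primitive idempotent. -/
def IsPrimitiveIdempotent {R : Type*} [Ring R] (e : R) : Prop :=
  IsIdempotentElem e ∧ e ≠ 0 ∧
    ∀ f g : R, IsIdempotentElem f → IsIdempotentElem g → f * g = 0 → g * f = 0 → e = f + g →
      f = 0 ∨ g = 0

/-- `R` is basic: it has a complete set `e₁, …, eₙ` of primitive orthogonal idempotents such that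
the left modules `R eᵢ` are pairwise non-isomorphic. -/
def IsBasicRing (R : Type*) [Ring R] : Prop :=
  ∃ (n : ℕ) (e : Fin n → R), CompleteOrthogonalIdempotents e ∧
    (∀ i, IsPrimitiveIdempotent (e i)) ∧
    ∀ i j, i ≠ j → IsEmpty (Ideal.span {e i} ≃ₗ[R] Ideal.span {e j})

/-- All simple `R`-modules are one-dimensional over `k`. -/
def HasOneDimensionalSimples (k : Type*) [Field k] (R : Type u) [Ring R] [Algebra k R] : Prop :=
  ∀ (S : Type u) [AddCommGroup S] [Module R S] [Module k S] [IsScalarTower k R S]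
    [IsSimpleModule R S], Module.finrank k S = 1

end

/-! Both sides describe an algebra `R` with an algebra map `π : R → Γ` that is split by an algebra
map `s` and whose kernel is nilpotent and satisfies `TwoSidedIdeal.HasRemovablePD`. These conditions
on the kernel depend only on the pair (ring, ideal) up to isomorphism, so what has to be matched is
the split epimorphism.

From arrows to bimodules: a concatenation of paths avoids `A` exactly when both factors do, so z ↦
z_{¬A} is an algebra endomorphism of kQ (`avoiding_mul`). Pre-removability lets it descend to kQ/I
(`kill`), where it vanishes on ⟨A+I⟩ and is the identity modulo ⟨A+I⟩; hence it splits the quotient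
map. The kernel is nilpotent because it comes from paths of positive length (`arrowIdeal_isNil`),
and `SplitKernel.algEquiv` turns the splitting into a split extension.

From bimodules to arrows (`exists_boundQuiver`): as simple modules are one-dimensional, Γ is spanned
by complete orthogonal idempotents e_v modulo a nilpotent ideal J
(`exists_completeOrthogonalIdempotents`). Then P = π⁻¹(J) = s(J) ⊕ ker π is a nilpotent ideal of
`R`. Modulo P², each Peirce component of P has a basis consisting of elements of s(J) and elements
of ker π. These are the arrows, and `A` is the set of those in ker π. Evaluation of paths is
surjective (`evalHom_surjective`) with admissible kernel I (`isAdmissible_ker_evalHom`). It sends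
paths through `A` into ker π and paths avoiding `A` into s(Γ). Since these two subspaces meet in
zero, I splits along `A`, and ⟨A+I⟩ corresponds to ker π.

Properness matches because arrows are non-zero in kQ/I, while the empty set of arrows generates the
zero ideal. -/

noncomputable section

/-! ### Invariance of finite projective dimension under ring isomorphisms -/

section ProjectiveDimension

variable {R : Type u} [Ring R] {R' : Type v} [Ring R'] (f : R ≃+* R')
  (K : TwoSidedIdeal R) (K' : TwoSidedIdeal R')

attribute [local instance] RingHomInvPair.of_ringEquiv

/-- The semilinear equivalence between corresponding ideals of isomorphic rings, as left modules. -/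
def TwoSidedIdeal.leftEquiv (h : ∀ x, x ∈ K ↔ f x ∈ K') :
    K ≃ₛₗ[RingHomClass.toRingHom f] K' where
  toFun x := ⟨f x, (h _).1 x.2⟩
  invFun y := ⟨f.symm y, (h _).2 (by simp)⟩
  map_add' x y := Subtype.ext (map_add f _ _)
  map_smul' r x := Subtype.ext (map_mul f _ _)
  left_inv x := Subtype.ext (by simp)
  right_inv x := Subtype.ext (by simp)

/-- The semilinear equivalence between corresponding ideals of isomorphic rings, as right
modules. -/
def TwoSidedIdeal.rightEquiv (h : ∀ x, x ∈ K ↔ f x ∈ K') :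
    K ≃ₛₗ[RingHomClass.toRingHom (RingEquiv.op f)] K' where
  toFun x := ⟨f x, (h _).1 x.2⟩
  invFun y := ⟨f.symm y, (h _).2 (by simp)⟩
  map_add' x y := Subtype.ext (map_add f _ _)
  map_smul' r x := Subtype.ext (map_mul f _ _)
  left_inv x := Subtype.ext (by simp)
  right_inv x := Subtype.ext (by simp)

variable {K K'}

theorem TwoSidedIdeal.HasFinitePDLeft.of_ringEquiv (h : ∀ x, x ∈ K ↔ f x ∈ K')
    (hK : K.HasFinitePDLeft) : K'.HasFinitePDLeft := by
  obtain ⟨n, hn⟩ := hK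
  exact ⟨n, ModuleCat.hasProjectiveDimensionLE_of_semiLinearEquiv.{u, v} (M := ModuleCat.of R K)
    (N := ModuleCat.of R' K') f (TwoSidedIdeal.leftEquiv f K K' h) n⟩

theorem TwoSidedIdeal.HasFinitePDRight.of_ringEquiv (h : ∀ x, x ∈ K ↔ f x ∈ K')
    (hK : K.HasFinitePDRight) : K'.HasFinitePDRight := by
  obtain ⟨n, hn⟩ := hK
  exact ⟨n, ModuleCat.hasProjectiveDimensionLE_of_semiLinearEquiv.{u, v}
    (M := ModuleCat.of Rᵐᵒᵖ K) (N := ModuleCat.of R'ᵐᵒᵖ K') (RingEquiv.op f)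
    (TwoSidedIdeal.rightEquiv f K K' h) n⟩

theorem TwoSidedIdeal.hasFinitePDLeft_iff_of_ringEquiv (h : ∀ x, x ∈ K ↔ f x ∈ K') :
    K.HasFinitePDLeft ↔ K'.HasFinitePDLeft :=
  ⟨.of_ringEquiv f h, .of_ringEquiv f.symm fun x => by simp [h]⟩

theorem TwoSidedIdeal.hasFinitePDRight_iff_of_ringEquiv (h : ∀ x, x ∈ K ↔ f x ∈ K') :
    K.HasFinitePDRight ↔ K'.HasFinitePDRight :=
  ⟨.of_ringEquiv f h, .of_ringEquiv f.symm fun x => by simp [h]⟩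

end ProjectiveDimension

/-! ### Split epimorphisms of algebras as split extensions -/

section SplitKernel

variable {k Γ R : Type*} [Field k] [Ring Γ] [Algebra k Γ] [Ring R] [Algebra k R]

/-- The kernel of `π`, as a `Γ`-bimodule through a section `s` of `π`. -/
def SplitKernel (_ : Γ →ₐ[k] R) (π : R →ₐ[k] Γ) : Type _ := LinearMap.ker π.toLinearMap

namespace SplitKernel

variable (s : Γ →ₐ[k] R) (π : R →ₐ[k] Γ)

instance : AddCommGroup (SplitKernel s π) :=
  inferInstanceAs (AddCommGroup (LinearMap.ker π.toLinearMap))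

instance : Module k (SplitKernel s π) :=
  inferInstanceAs (Module k (LinearMap.ker π.toLinearMap))

instance [Module.Finite k R] : Module.Finite k (SplitKernel s π) :=
  inferInstanceAs (Module.Finite k (LinearMap.ker π.toLinearMap))

variable {s π}

/-- The underlying element of the algebra. -/
def val : SplitKernel s π →ₗ[k] R := (LinearMap.ker π.toLinearMap).subtype

theorem val_injective : Function.Injective (val : SplitKernel s π → R) := Subtype.val_injective

@[simp] theorem map_val (x : SplitKernel s π) : π x.val = 0 := LinearMap.mem_ker.1 x.2

/-- An element of the kernel. -/
def mk (x : R) (h : π x = 0) : SplitKernel s π := ⟨x, LinearMap.mem_ker.2 h⟩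

@[simp] theorem val_mk (x : R) (h : π x = 0) : (mk x h : SplitKernel s π).val = x := rfl

@[ext] theorem ext {x y : SplitKernel s π} (h : x.val = y.val) : x = y := val_injective h

/-- The action depends on the section, which is why `s` is a parameter of the type although the
underlying space does not involve it. -/
instance : Module Γ (SplitKernel s π) where
  smul γ x := mk (s γ * x.val) (by simp)
  one_smul x := ext (show s 1 * x.val = _ by simp)
  mul_smul a b x := ext (show s (a * b) * x.val = s a * (s b * x.val) by simp [mul_assoc])
  smul_zero a := ext (show s a * val 0 = val 0 by simp)
  smul_add a x y := ext (show s a * val (x + y) = val (mk _ _ + mk _ _) by simp [mul_add])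
  add_smul a b x := ext (show s (a + b) * val x = val (mk _ _ + mk _ _) by simp [add_mul])
  zero_smul x := ext (show s 0 * val x = val 0 by simp)

instance : Module Γᵐᵒᵖ (SplitKernel s π) where
  smul γ x := mk (x.val * s γ.unop) (by simp)
  one_smul x := ext (show x.val * s 1 = _ by simp)
  mul_smul a b x := ext (show x.val * s (b.unop * a.unop) = x.val * s b.unop * s a.unop by
    simp [mul_assoc])
  smul_zero a := ext (show val 0 * s a.unop = val 0 by simp)
  smul_add a x y := ext (show val (x + y) * s a.unop = val (mk _ _ + mk _ _) by simp [add_mul])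
  add_smul a b x := ext (show val x * s (a.unop + b.unop) = val (mk _ _ + mk _ _) by
    simp [mul_add])
  zero_smul x := ext (show val x * s 0 = val 0 by simp)

@[simp] theorem val_smul (γ : Γ) (x : SplitKernel s π) : (γ • x).val = s γ * x.val := rfl

@[simp] theorem val_op_smul (γ : Γᵐᵒᵖ) (x : SplitKernel s π) :
    (γ • x).val = x.val * s γ.unop := rfl

instance : SMulCommClass Γ Γᵐᵒᵖ (SplitKernel s π) :=
  ⟨fun a b x => ext (by simp [mul_assoc])⟩

instance : IsScalarTower k Γ (SplitKernel s π) := ⟨fun c a x => ext (by simp)⟩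

instance : IsScalarTower k Γᵐᵒᵖ (SplitKernel s π) := ⟨fun c a x => ext (by simp)⟩

variable (s π) in
/-- The multiplication of the kernel. -/
def bimoduleMul : BimoduleMul Γ (SplitKernel s π) where
  θ := AddMonoidHom.mk' (fun x => AddMonoidHom.mk' (fun y => mk (x.val * y.val) (by simp))
      fun y z => ext (by simp [mul_add])) fun x y => by
        ext z; simp [add_mul]
  balanced x γ y := ext (by simp [mul_assoc])
  smul_left γ x y := ext (by simp [mul_assoc])
  smul_right x y γ := ext (by simp [mul_assoc])
  assoc x y z := ext (by simp [mul_assoc])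

@[simp] theorem val_bimoduleMul (x y : SplitKernel s π) :
    ((bimoduleMul s π).θ x y).val = x.val * y.val := rfl

variable (hs : ∀ γ, π (s γ) = γ)

/-- An algebra with a split epimorphism `π` is a split extension by the kernel of `π`. -/
def algEquiv : R ≃ₐ[k] SplitExtension (bimoduleMul s π) where
  -- The decomposition R = s(Γ) ⊕ ker π.
  toFun x := ⟨π x, mk (x - s (π x)) (by simp [hs])⟩
  invFun y := s y.fst + y.snd.val
  left_inv x := by simp
  right_inv y := by ext <;> simp [hs]
  map_add' x y := by
    ext
    · simp
    · simp; abel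
  map_mul' x y := by
    ext
    · simp
    · simp; noncomm_ring
  commutes' c := by
    rw [Algebra.algebraMap_eq_smul_one, Algebra.algebraMap_eq_smul_one]
    ext <;> simp

theorem algEquiv_mem_idealM_iff (x : R) :
    algEquiv hs x ∈ SplitExtension.idealM (bimoduleMul s π) ↔ π x = 0 :=
  TwoSidedIdeal.mem_ker _

end SplitKernel

end SplitKernel

/-! ### Paths passing through a set of arrows -/

namespace QuiverPath

variable {V : Type*} [Quiver V] (A : ∀ a b : V, Set (a ⟶ b))

theorem not_passesThrough_nil (a : V) :
    ¬ (⟨a, a, Quiver.Path.nil⟩ : QuiverPath V).PassesThrough A := by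
  rintro ⟨c, d, α, p₁, p₂, -, h⟩
  have := congrArg Quiver.Path.length h
  simp at this
  omega

theorem passesThrough_cons_iff {a b c : V} (p : Quiver.Path a b) (f : b ⟶ c) :
    (⟨a, c, p.cons f⟩ : QuiverPath V).PassesThrough A ↔
      (⟨a, b, p⟩ : QuiverPath V).PassesThrough A ∨ f ∈ A b c := by
  constructor
  · rintro ⟨c', d, α, p₁, p₂, hα, h⟩
    cases p₂ with
    | nil =>
      simp only [Quiver.Path.comp_nil, Quiver.Hom.toPath, Quiver.Path.comp_cons,
        Quiver.Path.cons.injEq] at h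
      obtain ⟨rfl, -, h⟩ := h
      right
      rwa [eq_of_heq h]
    | cons p₂ g =>
      simp only [Quiver.Path.comp_cons, Quiver.Path.cons.injEq] at h
      obtain ⟨rfl, h, -⟩ := h
      exact Or.inl ⟨c', d, α, p₁, p₂, hα, eq_of_heq h⟩
  · rintro (⟨c', d, α, p₁, p₂, hα, h⟩ | h)
    · exact ⟨c', d, α, p₁, p₂.cons f, hα, by simpa using h⟩
    · exact ⟨b, c, f, p, Quiver.Path.nil, h, rfl⟩

theorem passesThrough_comp_iff {a b c : V} (p : Quiver.Path a b) (q : Quiver.Path b c) :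
    (⟨a, c, p.comp q⟩ : QuiverPath V).PassesThrough A ↔
      (⟨a, b, p⟩ : QuiverPath V).PassesThrough A ∨ (⟨b, c, q⟩ : QuiverPath V).PassesThrough A := by
  induction q with
  | nil => simp [not_passesThrough_nil]
  | cons q f ih => simp only [Quiver.Path.comp_cons, passesThrough_cons_iff, ih, or_assoc]

theorem passesThrough_ofArrow {a b : V} {α : a ⟶ b} (h : α ∈ A a b) :
    (ofArrow α).PassesThrough A :=
  ⟨a, b, α, Quiver.Path.nil, Quiver.Path.nil, h, rfl⟩

end QuiverPath

/-! ### The projection onto paths avoiding `A`, and the length filtration -/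

namespace PathAlgebra

variable {k : Type*} [Field k] {V : Type*} [Quiver V]

theorem single_comp {a b c : V} (p : Quiver.Path a b) (q : Quiver.Path b c) :
    (single ⟨a, c, p.comp q⟩ 1 : PathAlgebra k V) = single ⟨a, b, p⟩ 1 * single ⟨b, c, q⟩ 1 := by
  rw [single_mul_single]
  simp [pathMul, QuiverPath.comp]

theorem single_mul_single_of_ne {p q : QuiverPath V} (h : p.tgt ≠ q.src) (c d : k) :
    (single p c * single q d : PathAlgebra k V) = 0 := by
  rw [single_mul_single]
  simp [pathMul, h]

/-- A linear map that is multiplicative on paths is multiplicative. -/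
theorem map_mul_of_single {R : Type*} [Ring R] [Algebra k R] (f : PathAlgebra k V →ₗ[k] R)
    (h : ∀ p q, f (single p 1 * single q 1) = f (single p 1) * f (single q 1))
    (x y : PathAlgebra k V) : f (x * y) = f x * f y := by
  induction x using induction_linear with
  | h0 => simp [zero_mul']
  | hadd x x' hx hx' => simp [add_mul', hx, hx', add_mul]
  | hs p a =>
    induction y using induction_linear with
    | h0 => simp [mul_zero']
    | hadd y y' hy hy' => simp [mul_add', hy, hy', mul_add]
    | hs q b =>
      rw [← smul_single_one p a, ← smul_single_one q b]
      simp only [smul_mul', mul_smul', map_smul, h, smul_mul_assoc, mul_smul_comm]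

theorem through_add_avoiding (A : ∀ a b : V, Set (a ⟶ b)) (z : PathAlgebra k V) :
    through A z + avoiding A z = z := by
  classical
  exact Finsupp.filter_add_filter_not (toFinsupp z) _

/-- The projection `z ↦ z_{¬A}` as a linear map. -/
def avoidingLin (A : ∀ a b : V, Set (a ⟶ b)) : PathAlgebra k V →ₗ[k] PathAlgebra k V where
  toFun := avoiding A
  map_add' x y := by
    classical exact Finsupp.filter_add
  map_smul' c x := by
    classical exact Finsupp.filter_smul

theorem avoiding_single_of_passesThrough {A : ∀ a b : V, Set (a ⟶ b)} {p : QuiverPath V}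
    (h : p.PassesThrough A) (c : k) : avoiding A (single p c) = 0 := by
  classical exact Finsupp.filter_single_of_neg _ (not_not.2 h)

theorem avoiding_single_of_not_passesThrough {A : ∀ a b : V, Set (a ⟶ b)} {p : QuiverPath V}
    (h : ¬ p.PassesThrough A) (c : k) : avoiding A (single p c) = single p c := by
  classical exact Finsupp.filter_single_of_pos _ h

/-- The paths through `A` span an ideal and the paths avoiding `A` span a complementary subalgebra,
because a concatenation meets `A` exactly when one of its factors does. -/
theorem avoiding_mul [Fintype V] (A : ∀ a b : V, Set (a ⟶ b)) (x y : PathAlgebra k V) :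
    avoiding A (x * y) = avoiding A x * avoiding A y := by
  refine map_mul_of_single (avoidingLin A) (fun p q => ?_) x y
  change avoiding A _ = avoiding A _ * avoiding A _
  obtain ⟨a, b, p⟩ := p
  obtain ⟨b', c, q⟩ := q
  by_cases h : b = b'
  · subst h
    rw [← single_comp]
    by_cases hp : (⟨a, b, p⟩ : QuiverPath V).PassesThrough A
    · rw [avoiding_single_of_passesThrough hp, zero_mul,
        avoiding_single_of_passesThrough ((QuiverPath.passesThrough_comp_iff A p q).2 (.inl hp))]
    by_cases hq : (⟨b, c, q⟩ : QuiverPath V).PassesThrough A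
    · rw [avoiding_single_of_passesThrough hq, mul_zero,
        avoiding_single_of_passesThrough ((QuiverPath.passesThrough_comp_iff A p q).2 (.inr hq))]
    rw [avoiding_single_of_not_passesThrough hp, avoiding_single_of_not_passesThrough hq,
      avoiding_single_of_not_passesThrough (by simp [QuiverPath.passesThrough_comp_iff, hp, hq]),
      single_comp]
  · rw [single_mul_single_of_ne h]
    by_cases hp : (⟨a, b, p⟩ : QuiverPath V).PassesThrough A
    · rw [avoiding_single_of_passesThrough hp, zero_mul]
      exact map_zero (avoidingLin A)
    by_cases hq : (⟨b', c, q⟩ : QuiverPath V).PassesThrough A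
    · rw [avoiding_single_of_passesThrough hq, mul_zero]
      exact map_zero (avoidingLin A)
    rw [avoiding_single_of_not_passesThrough hp, avoiding_single_of_not_passesThrough hq,
      single_mul_single_of_ne h]
    exact map_zero (avoidingLin A)

/-- The projection `z ↦ z_{¬A}` as an algebra endomorphism of the path algebra. -/
def avoidingHom [Fintype V] (A : ∀ a b : V, Set (a ⟶ b)) : PathAlgebra k V →ₐ[k] PathAlgebra k V :=
  AlgHom.ofLinearMap (avoidingLin A) (by
    rw [one_def, map_sum]
    exact Finset.sum_congr rfl fun v _ =>
      avoiding_single_of_not_passesThrough (QuiverPath.not_passesThrough_nil A v) 1)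
    (avoiding_mul A)

theorem toFinsupp_eq_sum (z : PathAlgebra k V) :
    z = ∑ p ∈ (toFinsupp z).support, z.coeff p • single p 1 := by
  conv_lhs => rw [← toFinsupp.symm_apply_apply z, ← Finsupp.sum_single (toFinsupp z)]
  rw [Finsupp.sum, map_sum]
  exact Finset.sum_congr rfl fun p _ => (smul_single_one p _).symm

/-- An element all of whose paths lie in a submodule lies in this submodule. -/
theorem mem_of_coeff {W : Submodule k (PathAlgebra k V)} {z : PathAlgebra k V}
    (h : ∀ p, z.coeff p ≠ 0 → single p 1 ∈ W) : z ∈ W := by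
  rw [toFinsupp_eq_sum z]
  exact W.sum_mem fun p hp => W.smul_mem _ (h p (Finsupp.mem_support_iff.1 hp))

theorem coeff_through {A : ∀ a b : V, Set (a ⟶ b)} {z : PathAlgebra k V} {p : QuiverPath V}
    (h : (through A z).coeff p ≠ 0) : p.PassesThrough A ∧ z.coeff p ≠ 0 := by
  classical
  have h' : Finsupp.filter (fun p => p.PassesThrough A) (toFinsupp z) p ≠ 0 := h
  rw [Finsupp.filter_apply] at h'
  split_ifs at h' with hp
  exacts [⟨hp, h'⟩, (h' rfl).elim]

theorem coeff_avoiding {A : ∀ a b : V, Set (a ⟶ b)} {z : PathAlgebra k V} {p : QuiverPath V}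
    (h : (avoiding A z).coeff p ≠ 0) : ¬ p.PassesThrough A ∧ z.coeff p ≠ 0 := by
  classical
  have h' : Finsupp.filter (fun p => ¬ p.PassesThrough A) (toFinsupp z) p ≠ 0 := h
  rw [Finsupp.filter_apply] at h'
  split_ifs at h' with hp
  exacts [(h' rfl).elim, ⟨hp, h'⟩]

theorem coeff_single_self (p : QuiverPath V) (c : k) : (single p c).coeff p = c :=
  Finsupp.single_eq_same

variable (k V) in
/-- The span of the paths of length at least `n`. -/
def lengthGE (n : ℕ) : Submodule k (PathAlgebra k V) :=
  Submodule.span k {z | ∃ p : QuiverPath V, n ≤ p.length ∧ z = single p 1}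

theorem single_mem_lengthGE {n : ℕ} {p : QuiverPath V} (h : n ≤ p.length) :
    (single p 1 : PathAlgebra k V) ∈ lengthGE k V n :=
  Submodule.subset_span ⟨p, h, rfl⟩

theorem mul_mem_lengthGE {m n : ℕ} {x y : PathAlgebra k V} (hx : x ∈ lengthGE k V m)
    (hy : y ∈ lengthGE k V n) : x * y ∈ lengthGE k V (m + n) := by
  induction hx using Submodule.span_induction with
  | zero => rw [zero_mul']; exact zero_mem _
  | add x x' _ _ hx hx' => rw [add_mul']; exact add_mem hx hx'
  | smul c x _ hx => rw [smul_mul']; exact Submodule.smul_mem _ _ hx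
  | mem x hx =>
    obtain ⟨⟨a, b, p⟩, hp, rfl⟩ := hx
    induction hy using Submodule.span_induction with
    | zero => rw [mul_zero']; exact zero_mem _
    | add x x' _ _ hx hx' => rw [mul_add']; exact add_mem hx hx'
    | smul c x _ hx => rw [mul_smul']; exact Submodule.smul_mem _ _ hx
    | mem y hy =>
      obtain ⟨⟨b', c, q⟩, hq, rfl⟩ := hy
      by_cases h : b = b'
      · subst h
        rw [← single_comp]
        exact single_mem_lengthGE (by simp_all [QuiverPath.length]; omega)
      · rw [single_mul_single_of_ne h]
        exact zero_mem _

theorem lengthGE_zero : lengthGE k V 0 = ⊤ :=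
  top_unique fun _ _ => mem_of_coeff fun _ _ => single_mem_lengthGE (Nat.zero_le _)

theorem exists_eq_comp_of_le_length {n : ℕ} {a b : V} (p : Quiver.Path a b) (h : n ≤ p.length) :
    ∃ (c : V) (q : Quiver.Path a c) (r : Quiver.Path c b), q.length = n ∧ p = q.comp r := by
  induction p with
  | nil => exact ⟨a, .nil, .nil, by simpa [eq_comm] using h, rfl⟩
  | cons p f ih =>
    rcases h.eq_or_lt with h | h
    · exact ⟨_, p.cons f, .nil, h.symm, rfl⟩
    · obtain ⟨c, q, r, hq, rfl⟩ := ih (by simpa [Nat.lt_succ_iff] using h)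
      exact ⟨c, q, r.cons f, hq, rfl⟩

/-- Admissibility speaks of paths of length exactly `N`; a longer path has such a path as its
initial segment. -/
theorem mem_of_mem_lengthGE [Fintype V] {I : TwoSidedIdeal (PathAlgebra k V)} {N : ℕ}
    (h : ∀ p : QuiverPath V, p.length = N → single p 1 ∈ I) {z : PathAlgebra k V}
    (hz : z ∈ lengthGE k V N) : z ∈ I := by
  induction hz using Submodule.span_induction with
  | zero => exact zero_mem _
  | add x y _ _ hx hy => exact add_mem hx hy
  | smul c x _ hx => rw [← one_mul x, ← smul_mul_assoc]; exact I.mul_mem_left _ _ hx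
  | mem x hx =>
    obtain ⟨⟨a, b, p⟩, hp, rfl⟩ := hx
    obtain ⟨c, q, r, hq, rfl⟩ := exists_eq_comp_of_le_length p hp
    rw [single_comp]
    exact I.mul_mem_right _ _ (h _ hq)

end PathAlgebra

/-! ### Conditions on an ideal common to both kinds of removability -/

/-- A two-sided ideal is nilpotent if all products of some fixed number of its elements vanish. -/
def TwoSidedIdeal.IsNil {R : Type*} [Ring R] (K : TwoSidedIdeal R) : Prop :=
  ∃ N : ℕ, ∀ l : List R, l.length = N → (∀ x ∈ l, x ∈ K) → l.prod = 0

/-- The square of the ideal vanishes. -/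
def TwoSidedIdeal.SquareZero {R : Type*} [Ring R] (K : TwoSidedIdeal R) : Prop :=
  ∀ x ∈ K, ∀ y ∈ K, x * y = 0

/-- The homological condition shared by removable sets of arrows and removable bimodules. -/
def TwoSidedIdeal.HasRemovablePD {R : Type*} [Ring R] (K : TwoSidedIdeal R) : Prop :=
  (K.HasFinitePDRight ∧ K.HasFinitePDLeft) ∨
    (K.SquareZero ∧ K.HasFinitePDRight ∧ ¬ K.HasFinitePDLeft)

namespace TwoSidedIdeal

variable {R R' : Type*} [Ring R] [Ring R'] (f : R ≃+* R')
  {K : TwoSidedIdeal R} {K' : TwoSidedIdeal R'}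

theorem SquareZero.of_ringEquiv (h : ∀ x, x ∈ K ↔ f x ∈ K') (hK : K.SquareZero) :
    K'.SquareZero := fun x hx y hy => by
  have := hK (f.symm x) (by simpa [h]) (f.symm y) (by simpa [h])
  rwa [← map_mul, map_eq_zero_iff _ f.symm.injective] at this

theorem HasRemovablePD.of_ringEquiv (h : ∀ x, x ∈ K ↔ f x ∈ K') (hK : K.HasRemovablePD) :
    K'.HasRemovablePD := by
  unfold HasRemovablePD
  rw [← hasFinitePDLeft_iff_of_ringEquiv f h, ← hasFinitePDRight_iff_of_ringEquiv f h]
  exact hK.imp_right fun hK => ⟨hK.1.of_ringEquiv f h, hK.2⟩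

theorem IsNil.of_ringEquiv (h : ∀ x, x ∈ K ↔ f x ∈ K') (hK : K.IsNil) : K'.IsNil := by
  obtain ⟨N, hN⟩ := hK
  refine ⟨N, fun l hl hlK => ?_⟩
  have := hN (l.map f.symm) (by simpa) (by simpa [h] using hlK)
  rwa [← map_list_prod, map_eq_zero_iff _ f.symm.injective] at this

end TwoSidedIdeal

/-! ### Removability of a bimodule in terms of the ideal 0 ⊕ M -/

namespace SplitExtension

variable {Γ M : Type*} [Ring Γ] [AddCommGroup M] [Module Γ M] [Module Γᵐᵒᵖ M]
  [SMulCommClass Γ Γᵐᵒᵖ M] {μ : BimoduleMul Γ M}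

theorem mem_idealM {x : SplitExtension μ} : x ∈ idealM μ ↔ x.fst = 0 := TwoSidedIdeal.mem_ker _

theorem prod_ofFn (r : ℕ) (m : Fin (r + 1) → M) :
    (List.ofFn fun i => (⟨0, m i⟩ : SplitExtension μ)).prod = ⟨0, μ.iter r m⟩ := by
  induction r with
  | zero => simp [BimoduleMul.iter]
  | succ r ih =>
    rw [List.ofFn_succ', List.concat_eq_append, List.prod_append]
    erw [ih (Fin.init m)]
    ext <;> simp [BimoduleMul.iter]

theorem isNilpotent_iff : μ.IsNilpotent ↔ (idealM μ).IsNil := by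
  constructor
  · rintro ⟨N, -, h⟩
    -- The map θ^N takes `N + 1` arguments.
    refine ⟨N + 1, fun l hl hlK => ?_⟩
    have : l = List.ofFn fun i : Fin (N + 1) =>
        (⟨0, (l.get (i.cast hl.symm)).snd⟩ : SplitExtension μ) := by
      apply List.ext_get
      · simp only [List.length_ofFn, hl]
      · intro n h₁ h₂
        rw [List.get_ofFn]
        exact SplitExtension.ext (mem_idealM.1 (hlK _ (l.get_mem ⟨n, h₁⟩))) rfl
    rw [this, prod_ofFn, h]
    rfl
  · rintro ⟨N, h⟩
    -- `IsNil` allows `N = 0`, whereas `IsNilpotent` asks for a positive exponent. A product of `N +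
    -- 2` factors vanishes because its first `N` factors already do.
    refine ⟨N + 1, N.succ_pos, fun m => ?_⟩
    have h₁ : (List.ofFn fun i => (⟨0, m i⟩ : SplitExtension μ)).prod = 0 := by
      rw [← List.prod_take_mul_prod_drop _ N, h _ (by simp; omega), zero_mul]
      intro x hx
      obtain ⟨i, rfl⟩ := List.mem_ofFn.1 (List.mem_of_mem_take hx)
      exact mem_idealM.2 rfl
    rw [prod_ofFn] at h₁
    exact congrArg snd h₁

theorem squareZero_idealM_iff : (idealM μ).SquareZero ↔ μ.θ = 0 := by
  constructor
  · intro h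
    ext x y
    simpa using congrArg snd (h ⟨0, x⟩ (mem_idealM.2 rfl) ⟨0, y⟩ (mem_idealM.2 rfl))
  · intro h x hx y hy
    rw [mem_idealM] at hx hy
    ext <;> simp [hx, hy, h]

theorem isRemovable_iff : μ.IsRemovable ↔ (idealM μ).IsNil ∧ (idealM μ).HasRemovablePD := by
  unfold BimoduleMul.IsRemovable BimoduleMul.IsTwoSidedRemovable BimoduleMul.IsOnlyLeftRemovable
    TwoSidedIdeal.HasRemovablePD
  rw [isNilpotent_iff, squareZero_idealM_iff]
  tauto

end SplitExtension

/-! ### The arrow ideal of a bound quiver algebra and its splitting -/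

namespace BoundQuiver

variable {k : Type*} [Field k] {Q : BoundQuiver k} (A : Q.ArrowSet)

theorem isRemovable_iff : IsRemovable A ↔ IsPreRemovable A ∧ (arrowIdeal A).HasRemovablePD := by
  unfold IsRemovable IsTwoSidedRemovable IsOnlyLeftRemovable
    TwoSidedIdeal.HasRemovablePD IsNonRepetitive TwoSidedIdeal.SquareZero
  tauto

/-- The projection of the path algebra to the bound quiver algebra. -/
def toAlg (Q : BoundQuiver k) : PathAlgebra k Q.V →ₐ[k] Q.Alg := Q.I.ringCon.mkₐ k

theorem toAlg_surjective (Q : BoundQuiver k) : Function.Surjective Q.toAlg :=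
  RingCon.mkₐ_surjective _

theorem toAlg_eq_zero_iff {z : PathAlgebra k Q.V} : Q.toAlg z = 0 ↔ z ∈ Q.I :=
  Q.I.ringCon.eq (a := z) (b := 0)

theorem toAlg_arrow_mem {a b : Q.V} {α : a ⟶ b} (h : α ∈ A a b) :
    Q.toAlg (PathAlgebra.single (QuiverPath.ofArrow α) 1) ∈ arrowIdeal A :=
  TwoSidedIdeal.subset_span ⟨a, b, α, h, rfl⟩

theorem toAlg_mem_of_passesThrough {p : QuiverPath Q.V} (h : p.PassesThrough A) :
    Q.toAlg (PathAlgebra.single p 1) ∈ arrowIdeal A := by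
  obtain ⟨a, b, p⟩ := p
  obtain ⟨c, d, α, p₁, p₂, hα, h⟩ := h
  dsimp only at p₁ p₂ h
  subst h
  rw [PathAlgebra.single_comp, PathAlgebra.single_comp, map_mul, map_mul]
  exact TwoSidedIdeal.mul_mem_right _ _ _ (TwoSidedIdeal.mul_mem_left _ _ _ (toAlg_arrow_mem A hα))

theorem toAlg_through_mem (z : PathAlgebra k Q.V) :
    Q.toAlg (PathAlgebra.through A z) ∈ arrowIdeal A := by
  rw [PathAlgebra.toFinsupp_eq_sum (PathAlgebra.through A z), map_sum]
  refine sum_mem fun p hp => ?_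
  rw [map_smul, ← one_mul (Q.toAlg _), ← smul_mul_assoc]
  exact TwoSidedIdeal.mul_mem_left _ _ _ (toAlg_mem_of_passesThrough A
    (PathAlgebra.coeff_through (Finsupp.mem_support_iff.1 hp)).1)

/-- Every element of the ideal lifts to a combination of paths of positive length, so a product of
`N` of them lifts to paths of length at least `N`, which lie in I. Nilpotency of the bimodule thus
needs no condition on `A`. -/
theorem arrowIdeal_isNil : (arrowIdeal A).IsNil := by
  obtain ⟨N, -, hN⟩ := Q.admissible.2
  have key : ∀ x ∈ arrowIdeal A, ∃ z ∈ PathAlgebra.lengthGE k Q.V 1, Q.toAlg z = x := by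
    intro x hx
    induction hx using TwoSidedIdeal.span_induction with
    | mem x hx =>
      obtain ⟨a, b, α, -, rfl⟩ := hx
      exact ⟨_, PathAlgebra.single_mem_lengthGE (p := QuiverPath.ofArrow α) le_rfl, rfl⟩
    | zero => exact ⟨0, zero_mem _, map_zero _⟩
    | add x y _ _ hx hy =>
      obtain ⟨z, hz, rfl⟩ := hx
      obtain ⟨w, hw, rfl⟩ := hy
      exact ⟨z + w, add_mem hz hw, map_add _ _ _⟩
    | neg x _ hx =>
      obtain ⟨z, hz, rfl⟩ := hx
      exact ⟨-z, neg_mem hz, map_neg _ _⟩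
    | left_absorb a x _ hx =>
      obtain ⟨z, hz, rfl⟩ := hx
      obtain ⟨w, rfl⟩ := Q.toAlg_surjective a
      exact ⟨w * z, by
        simpa using PathAlgebra.mul_mem_lengthGE (m := 0) (x := w)
          (by rw [PathAlgebra.lengthGE_zero]; trivial) hz, map_mul _ _ _⟩
    | right_absorb a x _ hx =>
      obtain ⟨z, hz, rfl⟩ := hx
      obtain ⟨w, rfl⟩ := Q.toAlg_surjective a
      exact ⟨z * w, by
        simpa using PathAlgebra.mul_mem_lengthGE (n := 0) (y := w) hz
          (by rw [PathAlgebra.lengthGE_zero]; trivial), map_mul _ _ _⟩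
  have key' : ∀ l : List Q.Alg, (∀ x ∈ l, x ∈ arrowIdeal A) →
      ∃ z ∈ PathAlgebra.lengthGE k Q.V l.length, Q.toAlg z = l.prod := by
    intro l hl
    induction l with
    | nil => exact ⟨1, by rw [List.length_nil, PathAlgebra.lengthGE_zero]; trivial, map_one _⟩
    | cons x l ih =>
      simp only [List.mem_cons, forall_eq_or_imp] at hl
      obtain ⟨z, hz, hzx⟩ := key x hl.1
      obtain ⟨w, hw, hwl⟩ := ih hl.2
      exact ⟨z * w, by
        simpa [add_comm] using PathAlgebra.mul_mem_lengthGE hz hw,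
        by rw [map_mul, hzx, hwl, List.prod_cons]⟩
  refine ⟨N, fun l hl hlA => ?_⟩
  obtain ⟨z, hz, hzl⟩ := key' l hlA
  rw [← hzl, toAlg_eq_zero_iff]
  exact PathAlgebra.mem_of_mem_lengthGE hN (hl ▸ hz)

/-- Paths occurring in I have length at least two. This makes M non-zero when `A` is non-empty. -/
theorem toAlg_arrow_ne_zero {a b : Q.V} (α : a ⟶ b) :
    Q.toAlg (PathAlgebra.single (QuiverPath.ofArrow α) 1) ≠ 0 := by
  rw [Ne, toAlg_eq_zero_iff]
  intro h
  have := Q.admissible.1 _ h (QuiverPath.ofArrow α)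
    (by rw [PathAlgebra.coeff_single_self]; exact one_ne_zero)
  simp [QuiverPath.length, QuiverPath.ofArrow] at this

variable {A}

/-- The endomorphism of the bound quiver algebra that kills the arrows of a pre-removable set. -/
def kill (hA : IsPreRemovable A) : Q.Alg →ₐ[k] Q.Alg :=
  RingCon.liftₐ _ (Q.toAlg.comp (PathAlgebra.avoidingHom A)) fun x y h => by
    have h' : x - y ∈ Q.I := (TwoSidedIdeal.rel_iff _ _ _).1 h
    change Q.toAlg (PathAlgebra.avoidingHom A x) = Q.toAlg (PathAlgebra.avoidingHom A y)
    rw [← sub_eq_zero, ← map_sub, ← map_sub, toAlg_eq_zero_iff]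
    exact (hA _ h').2

theorem kill_toAlg (hA : IsPreRemovable A) (z : PathAlgebra k Q.V) :
    kill hA (Q.toAlg z) = Q.toAlg (PathAlgebra.avoiding A z) := rfl

theorem kill_eq_zero (hA : IsPreRemovable A) {x : Q.Alg} (hx : x ∈ arrowIdeal A) :
    kill hA x = 0 := by
  have : arrowIdeal A ≤ TwoSidedIdeal.ker (kill hA) := by
    refine TwoSidedIdeal.span_le.2 ?_
    rintro x ⟨a, b, α, hα, rfl⟩
    refine (TwoSidedIdeal.mem_ker _).2 ((kill_toAlg hA _).trans ?_)
    rw [PathAlgebra.avoiding_single_of_passesThrough (QuiverPath.passesThrough_ofArrow A hα),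
      map_zero]
  exact (TwoSidedIdeal.mem_ker _).1 (this hx)

/-- The difference is the class of z_A for a lift z. Together with `kill_eq_zero` this makes `kill`
induce a section of the quotient map by the arrow ideal. -/
theorem sub_kill_mem (hA : IsPreRemovable A) (x : Q.Alg) : x - kill hA x ∈ arrowIdeal A := by
  obtain ⟨z, rfl⟩ := Q.toAlg_surjective x
  rw [kill_toAlg, ← map_sub, sub_eq_of_eq_add (PathAlgebra.through_add_avoiding A z).symm]
  exact toAlg_through_mem A z

end BoundQuiver

/-! ### Idempotents in algebras with one-dimensional simple modules -/

section OneDimensionalSimples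

variable {k : Type*} [Field k] {Γ : Type u} [Ring Γ] [Algebra k Γ]

/-- The simple module Γ/m is a line, so its k-linear endomorphisms are scalars and the action of Γ
is a character χ. If χ(x) = 0, then x annihilates the class of 1, so x lies in m. -/
theorem exists_algHom_of_isMaximal (h : HasOneDimensionalSimples k Γ) (m : Ideal Γ)
    [hm : m.IsMaximal] : ∃ χ : Γ →ₐ[k] k, ∀ x, χ x = 0 → x ∈ m := by
  have : IsSimpleModule Γ (Γ ⧸ m) := isSimpleModule_iff_isCoatom.2 (Ideal.isMaximal_def.1 hm)
  have h1 : Module.finrank k (Γ ⧸ m) = 1 := h (Γ ⧸ m)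
  have hb : Function.Bijective (Algebra.ofId k (Module.End k (Γ ⧸ m))) :=
    (LinearEquiv.smul_id_of_finrank_eq_one h1).bijective
  let E := AlgEquiv.ofBijective _ hb
  refine ⟨(E.symm : _ →ₐ[k] k).comp (Algebra.lsmul k k (Γ ⧸ m)), fun x hx => ?_⟩
  have hx' : Algebra.lsmul k k (Γ ⧸ m) x = 0 :=
    (map_eq_zero_iff E.symm E.symm.injective).1 hx
  have := LinearMap.congr_fun hx' (Submodule.Quotient.mk 1)
  simpa [← Submodule.Quotient.mk_smul] using this

variable [Module.Finite k Γ]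

/-- Linear independence of characters: a non-zero functional vanishing on the image would be a
linear relation between distinct characters. -/
theorem pi_algHom_surjective :
    Function.Surjective (AlgHom.pi fun χ : Γ →ₐ[k] k => χ) := by
  classical
  have := Fintype.ofFinite (Γ →ₐ[k] k)
  set F : Γ →ₗ[k] ((Γ →ₐ[k] k) → k) := (AlgHom.pi fun χ : Γ →ₐ[k] k => χ).toLinearMap
    with hF
  change Function.Surjective F
  rw [← LinearMap.range_eq_top]
  by_contra hr
  obtain ⟨f, hf, hle⟩ := Submodule.exists_le_ker_of_lt_top _ (lt_top_iff_ne_top.2 hr)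
  have key : ∑ χ : Γ →ₐ[k] k, f (Pi.single χ 1) • χ.toLinearMap = 0 := by
    ext x
    have h0 : f (F x) = 0 := hle ⟨x, rfl⟩
    rw [pi_eq_sum_univ' (F x), map_sum] at h0
    rw [LinearMap.sum_apply, LinearMap.zero_apply, ← h0]
    refine Finset.sum_congr rfl fun χ _ => ?_
    rw [map_smul, LinearMap.smul_apply, smul_eq_mul, smul_eq_mul, mul_comm]
    rfl
  have h0 := Fintype.linearIndependent_iff.1 (linearIndependent_algHom_toLinearMap k Γ k) _ key
  apply hf
  ext χ
  simpa using h0 χ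

theorem Ideal.list_prod_mem_pow {R : Type*} [Ring R] (I : Ideal R) (l : List R)
    (h : ∀ x ∈ l, x ∈ I) : l.prod ∈ I ^ l.length := by
  induction l using List.reverseRecOn with
  | nil =>
    rw [List.length_nil, Submodule.pow_zero, Ideal.one_eq_top]
    trivial
  | append_singleton l x ih =>
    rw [List.prod_append, List.prod_singleton, List.length_append, List.length_singleton,
      Submodule.pow_succ]
    exact Submodule.mul_mem_mul (ih fun y hy => h y (by simp [hy])) (h x (by simp))

/-- In a finite-dimensional algebra with one-dimensional simple modules there is a complete set of
orthogonal idempotents whose span complements a nilpotent ideal. -/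
theorem exists_completeOrthogonalIdempotents (h : HasOneDimensionalSimples k Γ) :
    ∃ (n : ℕ) (e : Fin n → Γ) (J : TwoSidedIdeal Γ), CompleteOrthogonalIdempotents e ∧
      (∀ i, e i ≠ 0) ∧ J.IsNil ∧ ∀ x, ∃ c : Fin n → k, x - ∑ i, c i • e i ∈ J := by
  classical
  have := Fintype.ofFinite (Γ →ₐ[k] k)
  set F : Γ →ₐ[k] ((Γ →ₐ[k] k) → k) := AlgHom.pi fun χ : Γ →ₐ[k] k => χ with hF
  have hA : IsArtinianRing Γ := IsArtinianRing.of_finite k Γ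
  obtain ⟨N, hN⟩ := IsArtinianRing.isNilpotent_jacobson_bot (R := Γ)
  -- An element killed by all characters lies in every maximal left ideal, hence in the Jacobson
  -- radical, which is nilpotent as Γ is Artinian. The coordinate idempotents of the product of
  -- copies of k therefore lift along `F`.
  have hJ : ∀ x, F x = 0 → x ∈ Ideal.jacobson (⊥ : Ideal Γ) := by
    intro x hx
    refine (Submodule.mem_sInf).2 ?_
    rintro m ⟨-, hm⟩
    obtain ⟨χ, hχ⟩ := exists_algHom_of_isMaximal h m
    exact hχ x (congrFun hx χ)
  have hnil : (TwoSidedIdeal.ker F).IsNil := by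
    refine ⟨N, fun l hl hlJ => ?_⟩
    have := Ideal.list_prod_mem_pow (Ideal.jacobson (⊥ : Ideal Γ)) l
      fun x hx => hJ x ((TwoSidedIdeal.mem_ker _).1 (hlJ x hx))
    rw [hl, hN] at this
    exact this
  let q := Fintype.equivFin (Γ →ₐ[k] k)
  obtain ⟨e, he, heF⟩ := CompleteOrthogonalIdempotents.lift_of_isNilpotent_ker F.toRingHom
    (fun x hx => ⟨N, by
      have := Ideal.pow_mem_pow (hJ x hx) N
      rw [hN] at this
      exact this⟩) (CompleteOrthogonalIdempotents.single fun _ : Γ →ₐ[k] k => k)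
    fun i => pi_algHom_surjective _
  have heF' : ∀ χ, F (e χ) = Pi.single χ 1 := fun χ => congrFun heF χ
  -- The coefficient of x at the idempotent belonging to χ is χ(x).
  refine ⟨_, e ∘ q.symm, TwoSidedIdeal.ker F, (CompleteOrthogonalIdempotents.equiv q.symm).2 he,
    fun i h0 => ?_, hnil, fun x => ⟨fun i => q.symm i x, ?_⟩⟩
  · have := congrFun (heF' (q.symm i)) (q.symm i)
    simp only [Function.comp_apply] at h0
    simp [h0] at this
  · have hs : ∑ i, q.symm i x • (e ∘ q.symm) i = ∑ χ, χ x • e χ :=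
      q.symm.sum_comp fun χ => χ x • e χ
    rw [hs, TwoSidedIdeal.mem_ker, map_sub, map_sum, sub_eq_zero]
    ext χ
    simp only [map_smul, heF', Finset.sum_apply, Pi.smul_apply, Pi.single_apply]
    simp [hF]

end OneDimensionalSimples

/-! ### Bases of a subspace modulo another -/

section Complement

variable {k V : Type*} [Field k] [AddCommGroup V] [Module k V] [Module.Finite k V]

/-- A finite family in `W` that is a basis of `W` modulo `P`. -/
theorem Submodule.exists_basis_mod (W P : Submodule k V) :
    ∃ (m : ℕ) (f : Fin m → V), (∀ i, f i ∈ W) ∧ W ≤ Submodule.span k (Set.range f) ⊔ P ∧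
      ∀ c : Fin m → k, ∑ i, c i • f i ∈ P → c = 0 := by
  let b := Module.finBasis k (W.map P.mkQ)
  choose f hfW hf using fun i => (b i).2
  refine ⟨_, f, hfW, fun x hx => ?_, fun c hc => ?_⟩
  · have hx' : P.mkQ x ∈ W.map P.mkQ := ⟨x, hx, rfl⟩
    have hr := congrArg Subtype.val (b.sum_repr ⟨_, hx'⟩)
    rw [AddSubmonoidClass.coe_finsetSum] at hr
    rw [← sub_add_cancel x (∑ i, b.repr ⟨_, hx'⟩ i • f i), add_comm]
    refine Submodule.add_mem_sup (Submodule.sum_mem _ fun i _ =>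
      Submodule.smul_mem _ _ (Submodule.subset_span ⟨i, rfl⟩)) ?_
    rw [← Submodule.Quotient.mk_eq_zero, ← Submodule.mkQ_apply, map_sub, sub_eq_zero, map_sum]
    refine hr.symm.trans (Finset.sum_congr rfl fun i _ => ?_)
    rw [map_smul, hf]
    rfl
  · have h0 : ∑ i, c i • b i = 0 := by
      ext
      rw [AddSubmonoidClass.coe_finsetSum]
      have := (Submodule.Quotient.mk_eq_zero P).2 hc
      rw [← Submodule.mkQ_apply, map_sum] at this
      refine Eq.trans (Finset.sum_congr rfl fun i _ => ?_) this
      rw [map_smul, hf]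
      rfl
    ext i
    exact Fintype.linearIndependent_iff.1 b.linearIndependent c h0 i

end Complement

/-! ### Evaluation of paths in an algebra: surjectivity and admissible kernel -/

namespace PathAlgebra

variable {k : Type*} [Field k] {V : Type*} [Quiver V] {R : Type*} [Ring R] [Algebra k R]

/-- The value of a path when vertices and arrows are sent to elements of a ring. -/
def evalPath (e : V → R) (x : ∀ a b : V, (a ⟶ b) → R) {a : V} : {b : V} → Quiver.Path a b → R
  | _, .nil => e a
  | _, .cons p f => evalPath e x p * x _ _ f

theorem apply_mem_of_single {W : Type*} [AddCommGroup W] [Module k W] {S : Submodule k W}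
    (T : PathAlgebra k V →ₗ[k] W) (h : ∀ p, T (single p 1) ∈ S) (z : PathAlgebra k V) :
    T z ∈ S := by
  have : (⊤ : Submodule k (PathAlgebra k V)) ≤ S.comap T :=
    fun _ _ => mem_of_coeff fun p _ => h p
  exact this trivial

/-- The coefficient of a path as a linear functional. -/
def coeffLin (p : QuiverPath V) : PathAlgebra k V →ₗ[k] k :=
  Finsupp.lapply p ∘ₗ toFinsupp.toLinearMap

theorem coeffLin_apply (p : QuiverPath V) (z : PathAlgebra k V) : coeffLin p z = z.coeff p := rfl

theorem coeff_single_of_ne {p q : QuiverPath V} (h : p ≠ q) (c : k) :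
    (single p c).coeff q = 0 := Finsupp.single_eq_of_ne h.symm

theorem _root_.QuiverPath.eq_trivial_of_length_eq_zero {p : QuiverPath V} (h : p.length = 0) :
    ∃ v, p = QuiverPath.trivial v := by
  obtain ⟨a, b, p⟩ := p
  cases p with
  | nil => exact ⟨a, rfl⟩
  | cons p f => simp [QuiverPath.length] at h

theorem _root_.QuiverPath.eq_ofArrow_of_length_eq_one {p : QuiverPath V} (h : p.length = 1) :
    ∃ f : Σ a b : V, (a ⟶ b), p = QuiverPath.ofArrow f.2.2 := by
  obtain ⟨a, b, p⟩ := p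
  cases p with
  | nil => simp [QuiverPath.length] at h
  | cons p f =>
    cases p with
    | nil => exact ⟨⟨_, _, f⟩, rfl⟩
    | cons p g => simp [QuiverPath.length] at h

theorem _root_.QuiverPath.trivial_injective :
    Function.Injective (QuiverPath.trivial : V → QuiverPath V) :=
  fun _ _ h => congrArg QuiverPath.src h

theorem _root_.QuiverPath.ofArrow_injective :
    Function.Injective fun f : Σ a b : V, (a ⟶ b) => QuiverPath.ofArrow f.2.2 := by
  rintro ⟨a, b, f⟩ ⟨a', b', f'⟩ h
  simp only [QuiverPath.ofArrow, QuiverPath.mk.injEq] at h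
  obtain ⟨rfl, rfl, h⟩ := h
  simp only [heq_eq_eq, Quiver.Hom.toPath, Quiver.Path.cons.injEq, true_and] at h
  rw [h]

theorem le_length_of_mem_lengthGE {n : ℕ} {z : PathAlgebra k V} (hz : z ∈ lengthGE k V n)
    {p : QuiverPath V} (hp : z.coeff p ≠ 0) : n ≤ p.length := by
  by_contra hn
  have : lengthGE k V n ≤ LinearMap.ker (coeffLin p) := by
    refine Submodule.span_le.2 ?_
    rintro _ ⟨q, hq, rfl⟩
    exact coeff_single_of_ne (by rintro rfl; exact hn hq) 1
  exact hp (this hz)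

/-- Positive length is essential: as a power of a subspace, `J ^ 0` is only the line k·1, which need
not contain the idempotents. The exponents `m + 1` below have the same origin. -/
theorem evalPath_mem_pow {e : V → R} {x : ∀ a b : V, (a ⟶ b) → R} {J : Submodule k R}
    (hJl : ∀ r, ∀ y ∈ J, r * y ∈ J) (hxJ : ∀ a b f, x a b f ∈ J) {a b : V} (p : Quiver.Path a b) (h : 0 < p.length) :
    evalPath e x p ∈ J ^ p.length := by
  induction p with
  | nil => simp at h
  | cons p f ih =>
    rw [evalPath, Quiver.Path.length_cons]
    rcases Nat.eq_zero_or_pos p.length with h0 | h0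
    · rw [h0, zero_add, pow_one]
      -- A path of length one evaluates to `e a * x a b f`, with the idempotent of its source in
      -- front.
      exact hJl _ _ (hxJ _ _ f)
    · rw [pow_succ]
      exact Submodule.mul_mem_mul (ih h0) (hxJ _ _ f)

variable [Fintype V] {e : V → R} (he : CompleteOrthogonalIdempotents e)
  {x : ∀ a b : V, (a ⟶ b) → R} (hr : ∀ a b f, x a b f * e b = x a b f)

include he in
theorem mul_evalPath {a b : V} (p : Quiver.Path a b) : e a * evalPath e x p = evalPath e x p := by
  induction p with
  | nil => exact he.idem a
  | cons p f ih => rw [evalPath, ← mul_assoc, ih]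

include he hr in
theorem evalPath_mul {a b : V} (p : Quiver.Path a b) : evalPath e x p * e b = evalPath e x p := by
  cases p with
  | nil => exact he.idem a
  | cons p f => rw [evalPath, mul_assoc, hr]

include he hr in
theorem evalPath_comp {a b c : V} (p : Quiver.Path a b) (q : Quiver.Path b c) :
    evalPath e x (p.comp q) = evalPath e x p * evalPath e x q := by
  induction q with
  | nil => exact (evalPath_mul he hr p).symm
  | cons q f ih => rw [Quiver.Path.comp_cons, evalPath, ih, evalPath, mul_assoc]

variable (k e x) in
/-- The linear extension of the evaluation of paths. -/
def evalLin : PathAlgebra k V →ₗ[k] R :=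
  Finsupp.lift R k (QuiverPath V) (fun p => evalPath e x p.path) ∘ₗ toFinsupp.toLinearMap

theorem evalLin_single (p : QuiverPath V) : evalLin k e x (single p 1) = evalPath e x p.path := by
  simp [evalLin, single]

/-- The algebra homomorphism from the path algebra determined by the images of vertices and
arrows. -/
def evalHom : PathAlgebra k V →ₐ[k] R :=
  AlgHom.ofLinearMap (evalLin k e x) (by
    rw [one_def, map_sum, ← he.complete]
    exact Finset.sum_congr rfl fun v _ => evalLin_single _)
    (map_mul_of_single _ fun p q => by
      obtain ⟨a, b, p⟩ := p
      obtain ⟨b', c, q⟩ := q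
      by_cases h : b = b'
      · subst h
        rw [← single_comp, evalLin_single, evalLin_single, evalLin_single, evalPath_comp he hr]
      · rw [single_mul_single_of_ne h, map_zero, evalLin_single, evalLin_single,
          ← evalPath_mul he hr p, ← mul_evalPath he q, mul_assoc, ← mul_assoc (e b),
          he.ortho h, zero_mul, mul_zero])

theorem evalHom_single (p : QuiverPath V) :
    evalHom (k := k) he hr (single p 1) = evalPath e x p.path := evalLin_single p

theorem evalHom_trivial (v : V) :
    evalHom (k := k) he hr (single (QuiverPath.trivial v) 1) = e v := evalHom_single ..

theorem evalHom_ofArrow (hl : ∀ a b f, e a * x a b f = x a b f) {a b : V} (f : a ⟶ b) :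
    evalHom (k := k) he hr (single (QuiverPath.ofArrow f) 1) = x a b f := by
  rw [evalHom_single]
  exact hl a b f

theorem sub_sum_trivial_mem (z : PathAlgebra k V) :
    z - ∑ v, z.coeff (QuiverPath.trivial v) • single (QuiverPath.trivial v) 1 ∈
      lengthGE k V 1 := by
  have := apply_mem_of_single (S := lengthGE k V 1) (LinearMap.id - ∑ v : V,
    (coeffLin (QuiverPath.trivial v)).smulRight (single (QuiverPath.trivial v) (1 : k)))
    (fun p => ?_) z
  · simpa [coeffLin_apply] using this
  simp only [LinearMap.sub_apply, LinearMap.id_apply, LinearMap.sum_apply,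
    LinearMap.smulRight_apply, coeffLin_apply]
  rcases Nat.eq_zero_or_pos p.length with h | h
  · obtain ⟨v, rfl⟩ := QuiverPath.eq_trivial_of_length_eq_zero h
    rw [Finset.sum_eq_single v (fun w _ hw => by
      rw [coeff_single_of_ne (QuiverPath.trivial_injective.ne hw.symm), zero_smul]) (by simp),
      coeff_single_self, one_smul, sub_self]
    exact zero_mem _
  · rw [Finset.sum_eq_zero fun w _ => ?_, sub_zero]
    · exact single_mem_lengthGE h
    · rw [coeff_single_of_ne (by rintro rfl; simp [QuiverPath.length, QuiverPath.trivial] at h),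
        zero_smul]

theorem sub_sum_arrow_mem [∀ a b : V, Fintype (a ⟶ b)] {z : PathAlgebra k V}
    (hz : z ∈ lengthGE k V 1) :
    z - ∑ f : Σ a b : V, (a ⟶ b), z.coeff (QuiverPath.ofArrow f.2.2) •
      single (QuiverPath.ofArrow f.2.2) 1 ∈ lengthGE k V 2 := by
  have : lengthGE k V 1 ≤ (lengthGE k V 2).comap (LinearMap.id - ∑ f : Σ a b : V, (a ⟶ b),
    (coeffLin (QuiverPath.ofArrow f.2.2)).smulRight
      (single (QuiverPath.ofArrow f.2.2) (1 : k))) := by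
    refine Submodule.span_le.2 ?_
    rintro _ ⟨p, h, rfl⟩
    simp only [SetLike.mem_coe, Submodule.mem_comap, LinearMap.sub_apply, LinearMap.id_apply,
      LinearMap.sum_apply, LinearMap.smulRight_apply, coeffLin_apply]
    rcases h.eq_or_lt with h | h
    · obtain ⟨f, rfl⟩ := QuiverPath.eq_ofArrow_of_length_eq_one h.symm
      rw [Finset.sum_eq_single f (fun w _ hw => by
        rw [coeff_single_of_ne (QuiverPath.ofArrow_injective.ne hw.symm), zero_smul]) (by simp),
        coeff_single_self, one_smul, sub_self]
      exact zero_mem _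
    · rw [Finset.sum_eq_zero fun w _ => ?_, sub_zero]
      · exact single_mem_lengthGE h
      · rw [coeff_single_of_ne (by rintro rfl; simp [QuiverPath.length, QuiverPath.ofArrow] at h),
          zero_smul]
  simpa [coeffLin_apply] using this hz

variable {J : Submodule k R} (hJl : ∀ r, ∀ y ∈ J, r * y ∈ J) (hJr : ∀ r, ∀ y ∈ J, y * r ∈ J)
  (hxJ : ∀ a b f, x a b f ∈ J)

include hJl in
theorem _root_.Submodule.mul_mem_pow_succ (m : ℕ) (r y : R) (hy : y ∈ J ^ (m + 1)) :
    r * y ∈ J ^ (m + 1) := by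
  rw [pow_succ'] at hy ⊢
  induction hy using Submodule.mul_induction_on' with
  | mem_mul_mem a ha b hb => rw [← mul_assoc]; exact Submodule.mul_mem_mul (hJl _ _ ha) hb
  | add a _ b _ ha hb => rw [mul_add]; exact add_mem ha hb

include hJr in
theorem _root_.Submodule.pow_succ_mul_mem (m : ℕ) (r y : R) (hy : y ∈ J ^ (m + 1)) :
    y * r ∈ J ^ (m + 1) := by
  rw [pow_succ] at hy ⊢
  induction hy using Submodule.mul_induction_on' with
  | mem_mul_mem a ha b hb => rw [mul_assoc]; exact Submodule.mul_mem_mul ha (hJr _ _ hb)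
  | add a _ b _ ha hb => rw [add_mul]; exact add_mem ha hb

include hJl in
theorem _root_.Submodule.pow_succ_succ_le (m : ℕ) : J ^ (m + 2) ≤ J ^ (m + 1) := by
  rw [pow_succ' J (m + 1)]
  exact Submodule.mul_le.2 fun a _ b hb => Submodule.mul_mem_pow_succ hJl m a b hb

include hJl hxJ in
theorem evalHom_mem_pow {m : ℕ} {z : PathAlgebra k V} (hz : z ∈ lengthGE k V (m + 1)) :
    evalHom he hr z ∈ J ^ (m + 1) := by
  have : lengthGE k V (m + 1) ≤ (J ^ (m + 1)).comap (evalHom he hr).toLinearMap := by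
    refine Submodule.span_le.2 ?_
    rintro _ ⟨p, h, rfl⟩
    simp only [SetLike.mem_coe, Submodule.mem_comap, AlgHom.toLinearMap_apply]
    rw [evalHom_single]
    have anti : Antitone fun n => J ^ (n + 1) :=
      antitone_nat_of_succ_le fun n => Submodule.pow_succ_succ_le hJl n
    obtain ⟨n, hn⟩ := Nat.exists_eq_add_of_le' h
    have h1 := evalPath_mem_pow hJl hxJ (e := e) p.path (Nat.lt_of_lt_of_le m.succ_pos h)
    rw [show p.path.length = (n + m) + 1 from hn] at h1
    exact anti (Nat.le_add_left m n) h1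
  exact this hz

variable (hspan : ∀ r, ∃ c : V → k, r - ∑ v, c v • e v ∈ J)
  (hgen : ∀ y ∈ J, ∃ z, evalHom he hr z ∈ J ∧ y - evalHom (k := k) he hr z ∈ J ^ 2)
  {N : ℕ} (hN : J ^ N = ⊥)

include hspan hgen hN in
-- The image S contains the idempotents, which span modulo J, and `hgen` gives J = (S ∩ J) + J².
-- Multiplying this out yields J^m ⊆ S + J^(m+1) for all m, and J is nilpotent.
theorem evalHom_surjective : Function.Surjective (evalHom (k := k) he hr) := by
  set S : Submodule k R := Subalgebra.toSubmodule (evalHom (k := k) he hr).range with hS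
  have h1 : ∀ m, J ^ m ≤ (S ⊓ J ^ m) ⊔ J ^ (m + 1) := by
    intro m
    induction m with
    | zero =>
      refine le_sup_of_le_left (le_inf ?_ le_rfl)
      rw [pow_zero, Submodule.one_le]
      exact one_mem (evalHom (k := k) he hr).range
    | succ m ih =>
      rw [pow_succ J m]
      refine Submodule.mul_le.2 fun a ha b hb => ?_
      obtain ⟨s, hs, a', ha', rfl⟩ := Submodule.mem_sup.1 (ih ha)
      obtain ⟨z, hz, hb'⟩ := hgen b hb
      set t := evalHom (k := k) he hr z with ht
      -- The first term is in S; the other two gain one power of `J`, from `b - t ∈ J ^ 2` and `a' ∈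
      -- J ^ (m + 1)` respectively.
      have : (s + a') * b = s * t + (s * (b - t) + a' * b) := by noncomm_ring
      rw [this]
      refine Submodule.add_mem_sup ⟨(evalHom (k := k) he hr).range.mul_mem hs.1 ⟨z, rfl⟩,
        Submodule.mul_mem_mul hs.2 hz⟩ (add_mem ?_ ?_)
      · rw [add_assoc, one_add_one_eq_two, pow_add]
        exact Submodule.mul_mem_mul hs.2 hb'
      · rw [pow_succ J (m + 1)]
        exact Submodule.mul_mem_mul ha' hb
  have h2 : ∀ m, (⊤ : Submodule k R) ≤ S ⊔ J ^ (m + 1) := by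
    intro m
    induction m with
    | zero =>
      rintro r -
      obtain ⟨c, hc⟩ := hspan r
      rw [zero_add, pow_one, ← add_sub_cancel (∑ v, c v • e v) r]
      refine Submodule.add_mem_sup (Submodule.sum_mem _ fun v _ => Submodule.smul_mem _ _ ?_) hc
      exact ⟨_, evalHom_trivial he hr v⟩
    | succ m ih =>
      exact ih.trans (sup_le le_sup_left ((h1 (m + 1)).trans (sup_le_sup_right inf_le_left _)))
  intro r
  have := h2 N (x := r) trivial
  rw [pow_succ, hN, Submodule.bot_mul, sup_bot_eq] at this
  exact this

include hJl hJr hxJ hN in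
-- For z in the kernel, reducing modulo J isolates the trivial paths and reducing modulo J² then
-- isolates the arrows. Their coefficients vanish because no idempotent lies in J and parallel
-- arrows are independent modulo J².
theorem isAdmissible_ker_evalHom [∀ a b : V, Fintype (a ⟶ b)]
    (hl : ∀ a b f, e a * x a b f = x a b f) (he0 : ∀ v, e v ∉ J)
    (hind : ∀ (a b : V) (c : (a ⟶ b) → k), ∑ f, c f • x a b f ∈ J ^ 2 → c = 0) :
    IsAdmissible (TwoSidedIdeal.ker (evalHom (k := k) he hr)) := by
  classical
  constructor
  · intro z hz p hp
    replace hz := (TwoSidedIdeal.mem_ker _).1 hz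
    have h1 : z ∈ lengthGE k V 1 := by
      have h := sub_sum_trivial_mem z
      have h' := evalHom_mem_pow he hr hJl hxJ (m := 0) h
      rw [map_sub, hz, zero_sub, zero_add, pow_one, neg_mem_iff, map_sum] at h'
      rw [Finset.sum_eq_zero fun v _ => ?_, sub_zero] at h
      · exact h
      suffices h0 : z.coeff (QuiverPath.trivial v) = 0 by rw [h0, zero_smul]
      by_contra h0
      -- Multiplication by `e v` extracts the single term at `v`.
      have h2 := hJl (e v) _ h'
      simp only [map_smul, evalHom_trivial, Finset.mul_sum, mul_smul_comm, he.mul_eq, smul_ite,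
        smul_zero, Finset.sum_ite_eq, Finset.mem_univ, if_true] at h2
      exact he0 v ((J.smul_mem_iff h0).1 h2)
    have h2 := sub_sum_arrow_mem h1
    have h2' := evalHom_mem_pow he hr hJl hxJ (m := 1) h2
    rw [map_sub, hz, zero_sub, neg_mem_iff, map_sum] at h2'
    simp only [map_smul, evalHom_ofArrow he hr hl] at h2'
    rw [Finset.sum_eq_zero fun f _ => ?_, sub_zero] at h2
    · exact le_length_of_mem_lengthGE h2 hp
    obtain ⟨a, b, f⟩ := f
    suffices h0 : (fun f : a ⟶ b => z.coeff (QuiverPath.ofArrow f)) = 0 by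
      rw [show z.coeff (QuiverPath.ofArrow f) = 0 from congrFun h0 f, zero_smul]
    apply hind
    -- Multiplication by `e a` on the left and `e b` on the right keeps only the arrows from `a` to
    -- `b`.
    have h3 := Submodule.pow_succ_mul_mem hJr 1 (e b) _
      (Submodule.mul_mem_pow_succ hJl 1 (e a) _ h2')
    convert h3 using 1
    simp only [Fintype.sum_sigma, Finset.mul_sum, Finset.sum_mul, mul_smul_comm, smul_mul_assoc]
    rw [Finset.sum_eq_single a, Finset.sum_eq_single b]
    · simp only [hl, hr]
    · intro b' _ hb
      refine Finset.sum_eq_zero fun f _ => ?_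
      rw [← hr, mul_assoc, mul_assoc, he.ortho hb, mul_zero, mul_zero, smul_zero]
    · simp
    · intro a' _ ha
      refine Finset.sum_eq_zero fun b' _ => Finset.sum_eq_zero fun f _ => ?_
      rw [← hl, ← mul_assoc, he.ortho ha.symm, zero_mul, zero_mul, smul_zero]
    · simp
  -- Adding 2 to the nilpotency exponent secures the bound `2 ≤ N` required of admissible ideals.
  · refine ⟨N + 2, by omega, fun p hp => (TwoSidedIdeal.mem_ker _).2 ?_⟩
    have := evalHom_mem_pow he hr hJl hxJ (m := N + 1)
      (single_mem_lengthGE (k := k) (le_of_eq hp.symm))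
    rwa [add_assoc, pow_add, hN, Submodule.bot_mul, Submodule.mem_bot] at this

end PathAlgebra

/-! ### Two-sided ideals as subspaces, and quotient algebras -/

namespace TwoSidedIdeal

variable {k R : Type*} [Field k] [Ring R] [Algebra k R]

variable (k) in
/-- A two-sided ideal of an algebra as a subspace. -/
def toSubspace (K : TwoSidedIdeal R) : Submodule k R where
  carrier := K
  add_mem' := K.add_mem
  zero_mem' := K.zero_mem
  smul_mem' c x hx := by
    rw [← one_mul x, ← smul_mul_assoc]
    exact K.mul_mem_left _ _ hx

theorem IsNil.exists_pow_eq_bot {K : TwoSidedIdeal R} (hK : K.IsNil) :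
    ∃ N, K.toSubspace k ^ N = ⊥ := by
  obtain ⟨N, hN⟩ := hK
  refine ⟨N, ?_⟩
  rw [Submodule.pow_eq_span_pow_set, Submodule.span_eq_bot]
  intro x hx
  obtain ⟨f, rfl⟩ := Set.mem_pow.1 hx
  refine hN _ (by simp) fun y hy => ?_
  obtain ⟨i, rfl⟩ := List.mem_ofFn.1 hy
  exact (f i).2

/-- The first isomorphism theorem. -/
theorem nonempty_quotient_algEquiv {S : Type*} [Ring S] [Algebra k S] (f : R →ₐ[k] S)
    (hf : Function.Surjective f) {K : TwoSidedIdeal R} (hK : ∀ x, x ∈ K ↔ f x = 0) :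
    ∃ g : K.ringCon.Quotient ≃ₐ[k] S, ∀ x, g (K.ringCon.mkₐ k x) = f x := by
  have h : ∀ x y, K.ringCon x y ↔ f x = f y := fun x y => by
    rw [TwoSidedIdeal.rel_iff, hK, map_sub, sub_eq_zero]
  refine ⟨AlgEquiv.ofBijective (K.ringCon.liftₐ f fun x y hxy => (h x y).1 hxy) ⟨?_, fun y => ?_⟩,
    fun x => rfl⟩
  · intro x y
    obtain ⟨x, rfl⟩ := RingCon.mkₐ_surjective (α := k) _ x
    obtain ⟨y, rfl⟩ := RingCon.mkₐ_surjective (α := k) _ y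
    exact fun hxy => (RingCon.eq _).2 ((h x y).2 hxy)
  · obtain ⟨x, rfl⟩ := hf y
    exact ⟨K.ringCon.mkₐ k x, rfl⟩

end TwoSidedIdeal

/-! ### A bound quiver adapted to a split nilpotent extension -/

section AdaptedQuiver

variable {k Γ R : Type*} [Field k] [Ring Γ] [Algebra k Γ] [Ring R] [Algebra k R]
  [Module.Finite k R]

/-- A split nilpotent extension of an algebra that is spanned by orthogonal idempotents and a
nilpotent ideal is a bound quiver algebra, the kernel being generated by arrows. -/
theorem exists_boundQuiver (s : Γ →ₐ[k] R) (π : R →ₐ[k] Γ) (hs : ∀ γ, π (s γ) = γ)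
    (hπ : (TwoSidedIdeal.ker π).IsNil) {V : Type} [Fintype V] {e : V → Γ}
    {J : TwoSidedIdeal Γ} (he : CompleteOrthogonalIdempotents e) (he0 : ∀ v, e v ≠ 0)
    (hJ : J.IsNil) (hspan : ∀ x, ∃ c : V → k, x - ∑ v, c v • e v ∈ J) :
    ∃ (Q : BoundQuiver k) (A : Q.ArrowSet) (ψ : Q.Alg ≃ₐ[k] R),
      BoundQuiver.IsPreRemovable A ∧ ∀ x, x ∈ BoundQuiver.arrowIdeal A ↔ π (ψ x) = 0 := by
  classical
  set P : Submodule k R := (J.toSubspace k).comap π.toLinearMap with hP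
  have hPmem : ∀ x, x ∈ P ↔ π x ∈ J := fun x => Iff.rfl
  have hPl : ∀ r, ∀ y ∈ P, r * y ∈ P := fun r y hy => by
    rw [hPmem, map_mul]
    exact J.mul_mem_left _ _ hy
  have hPr : ∀ r, ∀ y ∈ P, y * r ∈ P := fun r y hy => by
    rw [hPmem, map_mul]
    exact J.mul_mem_right _ _ hy
  have hKP : ∀ x, π x = 0 → x ∈ P := fun x hx => by
    rw [hPmem, hx]
    exact J.zero_mem
  have hsP : ∀ x ∈ P, s (π x) ∈ P := fun x hx => by
    rw [hPmem, hs]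
    exact hx
  -- The algebra endomorphism s ∘ π preserves P, hence P²; thus P² is compatible with the
  -- decomposition R = s(Γ) ⊕ ker π.
  have hsP2 : ∀ x ∈ P ^ 2, s (π x) ∈ P ^ 2 := by
    have : (P ^ 2).map (s.comp π).toLinearMap ≤ P ^ 2 := by
      rw [Submodule.map_pow]
      refine pow_le_pow_left' ?_ 2
      rintro _ ⟨x, hx, rfl⟩
      exact hsP x hx
    exact fun x hx => this ⟨x, hx, rfl⟩
  obtain ⟨N, hN⟩ : ∃ N, P ^ N = ⊥ := by
    obtain ⟨N₁, hN₁⟩ := hJ.exists_pow_eq_bot (k := k)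
    obtain ⟨N₂, hN₂⟩ := hπ.exists_pow_eq_bot (k := k)
    -- Modulo ker π the ideal P becomes J, so P^N₁ ⊆ ker π, and (ker π)^N₂ = 0.
    refine ⟨N₁ * N₂, ?_⟩
    rw [pow_mul, eq_bot_iff, ← hN₂]
    refine pow_le_pow_left' ?_ N₂
    intro x hx
    have h1 : π x ∈ (P ^ N₁).map π.toLinearMap := ⟨x, hx, rfl⟩
    rw [Submodule.map_pow] at h1
    have h2 : (P.map π.toLinearMap) ^ N₁ ≤ J.toSubspace k ^ N₁ := by
      refine pow_le_pow_left' ?_ N₁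
      rintro _ ⟨y, hy, rfl⟩
      exact hy
    have h3 := h2 h1
    rw [hN₁] at h3
    exact (TwoSidedIdeal.mem_ker _).2 h3
  have he' : CompleteOrthogonalIdempotents (s ∘ e) := he.map s.toRingHom
  have heP : ∀ v, (s ∘ e) v ∉ P := fun v hv => by
    rw [hPmem, Function.comp_apply, hs] at hv
    obtain ⟨n, hn⟩ := hJ
    have h0 := hn (List.replicate (n + 1) (e v)).tail (by simp)
      (by simp only [List.replicate_succ, List.tail_cons]; intro x hx
          rw [List.eq_of_mem_replicate hx]; exact hv)
    simp only [List.replicate_succ, List.tail_cons, List.prod_replicate] at h0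
    -- The extra factor makes the exponent positive, so that the power equals `e v` even when `n =
    -- 0`.
    have h1 : e v ^ (n + 1) = 0 := by rw [pow_succ, h0, zero_mul]
    rw [(he.idem v).pow_succ_eq] at h1
    exact he0 v h1
  -- The Peirce component s(e_a) R s(e_b), written as a space of common fixed points.
  let W : V → V → Submodule k R := fun a b =>
    LinearMap.ker (LinearMap.mulLeft k (s (e a)) - LinearMap.id) ⊓
      LinearMap.ker (LinearMap.mulRight k (s (e b)) - LinearMap.id)
  have hW : ∀ a b x, x ∈ W a b ↔ s (e a) * x = x ∧ x * s (e b) = x := fun a b x => by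
    simp [W, sub_eq_zero]
  -- Arrows from `a` to `b` are of two kinds: `f₁` lies in s(Γ) and `f₂` in ker π, each family being
  -- a basis of its part of the Peirce component of P modulo P².
  choose m₁ f₁ hf₁ hspan₁ hind₁ using fun a b =>
    Submodule.exists_basis_mod (W a b ⊓ P ⊓ LinearMap.range s.toLinearMap) (P ^ 2)
  choose m₂ f₂ hf₂ hspan₂ hind₂ using fun a b =>
    Submodule.exists_basis_mod (W a b ⊓ LinearMap.ker π.toLinearMap) (P ^ 2)
  have hf₁s : ∀ a b i, s (π (f₁ a b i)) = f₁ a b i := fun a b i => by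
    obtain ⟨γ, hγ⟩ := (hf₁ a b i).2
    rw [← hγ, AlgHom.toLinearMap_apply, hs]
  have hf₂π : ∀ a b i, π (f₂ a b i) = 0 := fun a b i => (hf₂ a b i).2
  let : Quiver.{0} V := ⟨fun a b => Fin (m₁ a b) ⊕ Fin (m₂ a b)⟩
  let hfin : ∀ a b : V, Fintype (a ⟶ b) := fun a b =>
    inferInstanceAs (Fintype (Fin (m₁ a b) ⊕ Fin (m₂ a b)))
  let x : ∀ a b : V, (a ⟶ b) → R := fun a b => Sum.elim (f₁ a b) (f₂ a b)
  have hxW : ∀ a b f, x a b f ∈ W a b := by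
    rintro a b (i | i)
    exacts [(hf₁ a b i).1.1, (hf₂ a b i).1]
  have hl : ∀ a b f, (s ∘ e) a * x a b f = x a b f := fun a b f => ((hW _ _ _).1 (hxW a b f)).1
  have hr : ∀ a b f, x a b f * (s ∘ e) b = x a b f := fun a b f => ((hW _ _ _).1 (hxW a b f)).2
  have hxP : ∀ a b f, x a b f ∈ P := by
    rintro a b (i | i)
    exacts [(hf₁ a b i).1.2, hKP _ (hf₂π a b i)]
  have hind : ∀ (a b : V) (c : (a ⟶ b) → k), ∑ f, c f • x a b f ∈ P ^ 2 → c = 0 := by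
    intro a b c hc
    have hsum : ∑ f, c f • x a b f =
        ∑ i, c (Sum.inl i) • f₁ a b i + ∑ i, c (Sum.inr i) • f₂ a b i :=
      Fintype.sum_sum_type fun f : Fin (m₁ a b) ⊕ Fin (m₂ a b) => c f • x a b f
    rw [hsum] at hc
    -- Applying s ∘ π fixes the `f₁` and kills the `f₂`, so the two partial sums lie in P²
    -- separately.
    have h1 := hsP2 _ hc
    simp only [map_add, map_sum, map_smul, hf₁s, hf₂π, smul_zero,
      Finset.sum_const_zero, add_zero] at h1
    have h2 := (Submodule.add_mem_iff_right _ h1).1 hc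
    funext f
    rcases f with i | i
    exacts [congrFun (hind₁ a b _ h1) i, congrFun (hind₂ a b _ h2) i]
  let φ : PathAlgebra k V →ₐ[k] R := PathAlgebra.evalHom he' hr
  have hφx : ∀ {a b : V} (f : a ⟶ b),
      φ (PathAlgebra.single (QuiverPath.ofArrow f) 1) = x a b f :=
    fun f => PathAlgebra.evalHom_ofArrow he' hr hl f
  set S : Submodule k R := LinearMap.range φ.toLinearMap with hS
  have hxS : ∀ a b f, x a b f ∈ S ⊓ P := fun a b f => ⟨⟨_, hφx f⟩, hxP a b f⟩
  have hle : P ≤ (S ⊓ P) ⊔ P ^ 2 := by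
    intro y hy
    have hsum : y = ∑ a, ∑ b, s (e a) * y * s (e b) := by
      simp only [← Finset.mul_sum, ← Finset.sum_mul]
      rw [show ∑ a, s (e a) = 1 from he'.complete, one_mul, mul_one]
    rw [hsum]
    refine Submodule.sum_mem _ fun a _ => Submodule.sum_mem _ fun b _ => ?_
    set w := s (e a) * y * s (e b) with hw
    have hwP : w ∈ P := hPr _ _ (hPl _ _ hy)
    have hπw : π w = e a * π y * e b := by simp [hw, hs]
    have hwl : s (e a) * w = w := by
      rw [hw, ← mul_assoc, ← mul_assoc, ← map_mul, he.idem a]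
    have hwr : w * s (e b) = w := by rw [hw, mul_assoc, ← map_mul, he.idem b]
    have hwW : w ∈ W a b := (hW _ _ _).2 ⟨hwl, hwr⟩
    have hswW : s (π w) ∈ W a b := by
      refine (hW _ _ _).2 ⟨?_, ?_⟩
      · conv_rhs => rw [← hwl, map_mul, hs, map_mul]
      · conv_rhs => rw [← hwr, map_mul, hs, map_mul]
    have h₁ := hspan₁ a b (x := s (π w)) ⟨⟨hswW, hsP _ hwP⟩, ⟨_, rfl⟩⟩
    have h₂ := hspan₂ a b (x := w - s (π w)) ⟨sub_mem hwW hswW, by simp [hs]⟩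
    -- Within a Peirce component, w splits into s(π(w)) in s(Γ) and a remainder in ker π; each is
    -- spanned by its kind of arrows modulo P².
    rw [← add_sub_cancel (s (π w)) w]
    refine add_mem ((sup_le_sup_right ?_ _ : _ ≤ (S ⊓ P) ⊔ P ^ 2) h₁)
      ((sup_le_sup_right ?_ _ : _ ≤ (S ⊓ P) ⊔ P ^ 2) h₂)
    · rw [Submodule.span_le]
      rintro _ ⟨i, rfl⟩
      exact hxS a b (Sum.inl i)
    · rw [Submodule.span_le]
      rintro _ ⟨i, rfl⟩
      exact hxS a b (Sum.inr i)
  have hgen : ∀ y ∈ P, ∃ z, φ z ∈ P ∧ y - φ z ∈ P ^ 2 := by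
    intro y hy
    obtain ⟨t, ⟨⟨z, rfl⟩, ht⟩, w, hw, rfl⟩ := Submodule.mem_sup.1 (hle hy)
    exact ⟨z, ht, by simpa using hw⟩
  have hspan' : ∀ r, ∃ c : V → k, r - ∑ v, c v • (s ∘ e) v ∈ P := by
    intro r
    obtain ⟨c, hc⟩ := hspan (π r)
    exact ⟨c, by simpa [hPmem, hs] using hc⟩
  have hφ : Function.Surjective φ :=
    PathAlgebra.evalHom_surjective he' hr hspan' hgen hN
  let Q : BoundQuiver k :=
    { V := V
      I := TwoSidedIdeal.ker φ
      admissible := PathAlgebra.isAdmissible_ker_evalHom he' hr hPl hPr hxP hN hl heP hind }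
  let A : Q.ArrowSet := fun a b => {f : Fin (m₁ a b) ⊕ Fin (m₂ a b) | ∃ i, f = Sum.inr i}
  have hI : ∀ z, z ∈ Q.I ↔ φ z = 0 := fun z => TwoSidedIdeal.mem_ker _
  obtain ⟨ψ, hψ⟩ := TwoSidedIdeal.nonempty_quotient_algEquiv φ hφ hI
  have hthrough : ∀ z, π (φ (PathAlgebra.through A z)) = 0 := by
    intro z
    suffices h : PathAlgebra.through A z ∈ LinearMap.ker (π.comp φ).toLinearMap from h
    refine PathAlgebra.mem_of_coeff fun p hp => ?_
    obtain ⟨a, b, p⟩ := p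
    obtain ⟨c, d, α, p₁, p₂, ⟨i, rfl⟩, hp⟩ := (PathAlgebra.coeff_through hp).1
    dsimp only at p₁ p₂ hp
    subst hp
    rw [LinearMap.mem_ker, AlgHom.toLinearMap_apply, AlgHom.comp_apply, PathAlgebra.single_comp,
      PathAlgebra.single_comp, map_mul, map_mul, map_mul, map_mul]
    have : φ (PathAlgebra.single ⟨c, d, Quiver.Hom.toPath (Sum.inr i)⟩ 1) = f₂ c d i := hφx _
    rw [this, hf₂π, mul_zero, zero_mul]
  have hpath : ∀ {a b : V} (p : Quiver.Path a b), ¬ (⟨a, b, p⟩ : QuiverPath V).PassesThrough A →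
      s (π (PathAlgebra.evalPath (s ∘ e) x p)) = PathAlgebra.evalPath (s ∘ e) x p := by
    intro a b p hp
    induction p with
    | nil => simp [PathAlgebra.evalPath, hs]
    | cons p f ih =>
      rw [QuiverPath.passesThrough_cons_iff, not_or] at hp
      rw [PathAlgebra.evalPath, map_mul, map_mul, ih hp.1]
      rcases f with i | i
      · congr 1
        exact hf₁s _ _ i
      · exact (hp.2 ⟨i, rfl⟩).elim
  have havoiding : ∀ z, s (π (φ (PathAlgebra.avoiding A z))) = φ (PathAlgebra.avoiding A z) := by
    intro z
    suffices h : PathAlgebra.avoiding A z ∈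
        LinearMap.ker (((s.comp π).comp φ).toLinearMap - φ.toLinearMap) by
      simpa [sub_eq_zero] using h
    refine PathAlgebra.mem_of_coeff fun p hp => ?_
    have h := hpath p.path (PathAlgebra.coeff_avoiding hp).1
    rw [← PathAlgebra.evalHom_single (k := k) he' hr p] at h
    simpa [sub_eq_zero] using h
  -- The value of z_{¬A} lies in s(Γ), and in ker π together with the value of z, hence is zero.
  -- This gives both pre-removability and the inclusion of ker π in the arrow ideal.
  have hzero : ∀ z, π (φ z) = 0 → φ (PathAlgebra.avoiding A z) = 0 := by
    intro z hz
    rw [← PathAlgebra.through_add_avoiding A z, map_add, map_add, hthrough, zero_add] at hz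
    rw [← havoiding, hz, map_zero]
  refine ⟨Q, A, ψ, fun z hz => ?_, fun y => ⟨fun hy => ?_, fun hy => ?_⟩⟩
  · have h1 := hzero z (by rw [(hI z).1 hz, map_zero])
    refine ⟨(hI _).2 ?_, (hI _).2 h1⟩
    have h2 := (hI z).1 hz
    rwa [← PathAlgebra.through_add_avoiding A z, map_add, h1, add_zero] at h2
  · have : BoundQuiver.arrowIdeal A ≤ TwoSidedIdeal.ker (π.comp (ψ : Q.Alg →ₐ[k] R)) := by
      refine TwoSidedIdeal.span_le.2 ?_
      rintro _ ⟨a, b, α, ⟨i, rfl⟩, rfl⟩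
      refine (TwoSidedIdeal.mem_ker _).2 ((congrArg π (hψ _)).trans ?_)
      rw [hφx]
      exact hf₂π a b i
    exact (TwoSidedIdeal.mem_ker (π.comp (ψ : Q.Alg →ₐ[k] R))).1 (this hy)
  · obtain ⟨z, rfl⟩ := Q.toAlg_surjective y
    have h1 : φ (PathAlgebra.avoiding A z) = 0 := hzero z ((congrArg π (hψ z)).symm.trans hy)
    have h2 := BoundQuiver.toAlg_through_mem A z
    rw [← PathAlgebra.through_add_avoiding A z, map_add,
      BoundQuiver.toAlg_eq_zero_iff.2 ((hI _).2 h1), add_zero]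
    exact h2

end AdaptedQuiver

/-! ### The two directions of the correspondence -/

section Main

variable {k : Type*} [Field k] {Γ Λ : Type*} [Ring Γ] [Algebra k Γ] [Ring Λ] [Algebra k Λ]

theorem IsArrowRemovalVia.exists_split {Q : BoundQuiver k} {A : Q.ArrowSet}
    (h : IsArrowRemovalVia k Γ Λ Q A) :
    ∃ (s : Γ →ₐ[k] Λ) (π : Λ →ₐ[k] Γ), (∀ γ, π (s γ) = γ) ∧
      (SplitKernel.bimoduleMul s π).IsRemovable ∧
      (BoundQuiver.ArrowSetNonempty A → Nontrivial (SplitKernel s π)) := by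
  obtain ⟨hA, ⟨f⟩, ⟨g⟩⟩ := h
  obtain ⟨hA, hpd⟩ := (BoundQuiver.isRemovable_iff A).1 hA
  set K := BoundQuiver.arrowIdeal A with hK
  let q : Q.Alg →ₐ[k] K.ringCon.Quotient := K.ringCon.mkₐ k
  have hq : ∀ y, q y = 0 ↔ y ∈ K := fun y => K.ringCon.eq (a := y) (b := 0)
  -- The section of the quotient map: `kill` vanishes on the arrow ideal, so it factors through the
  -- quotient.
  let τ : K.ringCon.Quotient →ₐ[k] Q.Alg := K.ringCon.liftₐ (BoundQuiver.kill hA) fun x y hxy => by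
    have := BoundQuiver.kill_eq_zero hA ((TwoSidedIdeal.rel_iff _ _ _).1 hxy)
    rw [map_sub, sub_eq_zero] at this
    exact this
  have hτ : ∀ y, q (τ y) = y := by
    intro y
    obtain ⟨y, rfl⟩ := RingCon.mkₐ_surjective (α := k) _ y
    change q (BoundQuiver.kill hA y) = q y
    rw [eq_comm, ← sub_eq_zero, ← map_sub, hq]
    exact BoundQuiver.sub_kill_mem hA y
  let π : Λ →ₐ[k] Γ := (g.symm : _ →ₐ[k] Γ).comp (q.comp (f : Λ →ₐ[k] Q.Alg))
  let s : Γ →ₐ[k] Λ := (f.symm : _ →ₐ[k] Λ).comp (τ.comp (g : Γ →ₐ[k] _))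
  have hπ : ∀ y, π (f.symm y) = 0 ↔ y ∈ K := fun y => by
    rw [← hq]
    change g.symm (q (f (f.symm y))) = 0 ↔ _
    rw [f.apply_symm_apply, map_eq_zero_iff _ g.symm.injective]
  have hs : ∀ γ, π (s γ) = γ := fun γ => by
    change g.symm (q (f (f.symm (τ (g γ))))) = γ
    rw [f.apply_symm_apply, hτ, g.symm_apply_apply]
  let E := f.symm.trans (SplitKernel.algEquiv hs)
  have hE : ∀ y, y ∈ K ↔ E.toRingEquiv y ∈ SplitExtension.idealM (SplitKernel.bimoduleMul s π) :=
    fun y => (hπ y).symm.trans (SplitKernel.algEquiv_mem_idealM_iff hs (f.symm y)).symm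
  refine ⟨s, π, hs, SplitExtension.isRemovable_iff.2
    ⟨(BoundQuiver.arrowIdeal_isNil A).of_ringEquiv E.toRingEquiv hE,
      hpd.of_ringEquiv E.toRingEquiv hE⟩, ?_⟩
  rintro ⟨a, b, α, hα⟩
  refine ⟨⟨SplitKernel.mk _ ((hπ _).2 (BoundQuiver.toAlg_arrow_mem A hα)), 0, fun h0 => ?_⟩⟩
  have h1 := congrArg SplitKernel.val h0
  rw [SplitKernel.val_mk, map_zero, map_eq_zero_iff _ f.symm.injective] at h1
  exact BoundQuiver.toAlg_arrow_ne_zero α h1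

theorem exists_isArrowRemovalVia [Module.Finite k Γ] (h1 : HasOneDimensionalSimples k Γ)
    {M : Type*} [AddCommGroup M] [Module k M] [Module Γ M] [Module Γᵐᵒᵖ M]
    [SMulCommClass Γ Γᵐᵒᵖ M] [IsScalarTower k Γ M] [IsScalarTower k Γᵐᵒᵖ M] [Module.Finite k M]
    {μ : BimoduleMul Γ M} (hμ : μ.IsRemovable) (f : Λ ≃ₐ[k] SplitExtension μ) :
    ∃ (Q : BoundQuiver k) (A : Q.ArrowSet), IsArrowRemovalVia k Γ Λ Q A ∧
      (Nontrivial M → BoundQuiver.ArrowSetNonempty A) := by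
  obtain ⟨hnil, hpd⟩ := SplitExtension.isRemovable_iff.1 hμ
  obtain ⟨n, e, J, he, he0, hJ, hspan⟩ := exists_completeOrthogonalIdempotents h1
  let π : SplitExtension μ →ₐ[k] Γ := AlgHom.ofLinearMap
    { toFun := SplitExtension.fst, map_add' := fun _ _ => rfl, map_smul' := fun _ _ => rfl }
    rfl fun _ _ => rfl
  let s : Γ →ₐ[k] SplitExtension μ := AlgHom.ofLinearMap
    { toFun := fun γ => ⟨γ, 0⟩
      map_add' := fun _ _ => by ext <;> simp
      map_smul' := fun _ _ => by ext <;> simp }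
    rfl fun _ _ => by ext <;> simp
  have hs : ∀ γ, π (s γ) = γ := fun _ => rfl
  have hker : ∀ y, y ∈ SplitExtension.idealM μ ↔ π y = 0 := fun y => SplitExtension.mem_idealM
  have : Module.Finite k (SplitExtension μ) := Module.Finite.equiv
    ({ SplitExtension.equivProd μ with
      map_add' := fun _ _ => rfl
      map_smul' := fun _ _ => rfl } : SplitExtension μ ≃ₗ[k] Γ × M).symm
  obtain ⟨Q, A, ψ, hA, hψ⟩ := exists_boundQuiver s π hs hnil he he0 hJ hspan
  obtain ⟨g, -⟩ := TwoSidedIdeal.nonempty_quotient_algEquiv (π.comp (ψ : Q.Alg →ₐ[k] _))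
    (fun γ => ⟨ψ.symm (s γ), by simp [hs]⟩) hψ
  refine ⟨Q, A, ⟨(BoundQuiver.isRemovable_iff A).2 ⟨hA, ?_⟩, ⟨f.trans ψ.symm⟩, ⟨g.symm⟩⟩, ?_⟩
  · exact hpd.of_ringEquiv ψ.symm.toRingEquiv fun y => by
      rw [hker]
      exact (iff_of_eq (by simp)).trans (hψ (ψ.symm y)).symm
  · intro hM
    obtain ⟨m, hm⟩ := exists_ne (0 : M)
    by_contra hne
    -- If `A` were empty, its ideal would be zero, but it corresponds to 0 ⊕ M, which contains (0,
    -- m).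
    have hbot : BoundQuiver.arrowIdeal A ≤ ⊥ := by
      refine TwoSidedIdeal.span_le.2 ?_
      rintro _ ⟨a, b, α, hα, -⟩
      exact (hne ⟨a, b, α, hα⟩).elim
    have h0 : ψ.symm ⟨0, m⟩ = 0 := (TwoSidedIdeal.mem_bot _).1
      (hbot ((hψ _).2 (by rw [ψ.apply_symm_apply]; rfl)))
    rw [map_eq_zero_iff _ ψ.symm.injective] at h0
    exact hm (congrArg SplitExtension.snd h0)

end Main

end

theorem mainTheorem7 {k : Type*} [Field k] {Γ Λ : Type*} [Ring Γ] [Algebra k Γ] [Module.Finite k Γ]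
    [Ring Λ] [Algebra k Λ] [Module.Finite k Λ]
    (hΓ : IsBasicRing Γ) (hΓ1 : HasOneDimensionalSimples k Γ)
    (hΛ : IsBasicRing Λ) (hΛ1 : HasOneDimensionalSimples k Λ) :
    (IsGeneralizedArrowRemoval k Γ Λ ↔ IsRemovableSplitExtension k Γ Λ) ∧
      (IsProperGeneralizedArrowRemoval k Γ Λ ↔ IsProperRemovableSplitExtension k Γ Λ) := by
  refine ⟨⟨?_, ?_⟩, ⟨?_, ?_⟩⟩
  · rintro ⟨Q, A, h⟩
    obtain ⟨s, π, hs, hμ, -⟩ := h.exists_split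
    exact ⟨SplitKernel s π, inferInstance, inferInstance, inferInstance, inferInstance,
      inferInstance, inferInstance, inferInstance, inferInstance, SplitKernel.bimoduleMul s π,
      hμ, ⟨SplitKernel.algEquiv hs⟩⟩
  · rintro ⟨M, _, _, _, _, _, _, _, _, μ, hμ, ⟨f⟩⟩
    obtain ⟨Q, A, h, -⟩ := exists_isArrowRemovalVia hΓ1 hμ f
    exact ⟨Q, A, h⟩
  · rintro ⟨Q, A, hA, h⟩
    obtain ⟨s, π, hs, hμ, hM⟩ := h.exists_split
    exact ⟨SplitKernel s π, inferInstance, inferInstance, inferInstance, inferInstance,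
      inferInstance, inferInstance, inferInstance, inferInstance, SplitKernel.bimoduleMul s π,
      hM hA, hμ, ⟨SplitKernel.algEquiv hs⟩⟩
  · rintro ⟨M, _, _, _, _, _, _, _, _, μ, hM, hμ, ⟨f⟩⟩
    obtain ⟨Q, A, h, hA⟩ := exists_isArrowRemovalVia hΓ1 hμ f
    exact ⟨Q, A, hA hM, h⟩
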